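/- Let $A,B\subset\mathbb R^2$ be finite point sets with $n=|A|\ge k=|B|\ge 1$. A matching is an injection $\sigma:B\hookrightarrow A$. For $t\in\mathbb R^2$ let $g_\sigma(t)\in\mathbb R^k$ be the vector of the edge lengths $\|b+t-\sigma(b)\|$, $b\in B$, sorted in decreasing order; such vectors are compared in the lexicographic order $\preceq$. A lex-bottleneck diagram for $A$ and $B$ is a polyhedral complex covering $\mathbb R^2$ such that for every face $c$ there is a matching $\pi_c$ with $g_{\pi_c}(t)\preceq g_\sigma(t)$ for all $t$ in the relative interior of $c$ and all matchings $\sigma$. Its complexity is the total number of its nonempty faces of all dimensions. For $a,a'\in A$ and $b,b'\in B$ with $b-a\ne b'-a'$ let $h(a,b,a',b')=\{t\in\mathbb R^2:\|b+t-a\|=\|b'+t-a'\|\}$ (a bisector), and let $\mathrm{lex}(A,B)$ be the arrangement of all these lines. For $t\in\mathbb R^2$ let $Z(t)$ be the set of all pairs $(a,b)\in A\times B$ for which fewer than $k$ points $a''\in A$ satisfy $\|b+t-a''\|<\|b+t-a\|$; it is constant in the interior of each two-dimensional face (cell) $C$ of $\mathrm{lex}(A,B)$, where it is denoted by $Z(C)$.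 A bisector $h$ is used if $h=h(a,b,a',b')$ for some such $a,b,a',b'$ and there is an edge $F\subset h$ of $\mathrm{lex}(A,B)$ between two cells $C,D$ of $\mathrm{lex}(A,B)$ with $(a,b),(a',b')\in Z(C)\cup Z(D)$. **Theorem.** There is a lex-bottleneck diagram for $A$ and $B$ of complexity $O(n^2k^6)$. More precisely, there is an absolute constant $K$ such that for all $A,B$ as above, the number of used bisectors is at most $K\,nk^3$, and the arrangement obtained from $\mathrm{lex}(A,B)$ by discarding all bisectors that are not used is a lex-bottleneck diagram for $A$ and $B$ with complexity at most $K\,n^2k^6$. -/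

import Mathlib

noncomputable section

/-- The Euclidean plane. -/
abbrev Plane := EuclideanSpace ℝ (Fin 2)

/-! ### Polyhedral complexes in the plane -/

/-- A convex polyhedron: the solution set of finitely many (weak) affine inequalities. -/
def IsPolyhedron (P : Set Plane) : Prop :=
  ∃ s : Finset (StrongDual ℝ Plane × ℝ), P = {x | ∀ c ∈ s, c.1 x ≤ c.2}

/-- `F` is a nonempty face of `P`: the set of maximizers of a linear functional over `P`
(the zero functional gives `P` itself). -/
def IsFaceOf (F P : Set Plane) : Prop :=
  F.Nonempty ∧ IsExposed ℝ P F

/-- A (finite) polyhedral complex, given by the collection of all its nonempty faces, of all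
dimensions. -/
structure IsPolyhedralComplex (T : Set (Set Plane)) : Prop where
  finite : T.Finite
  polyhedron : ∀ c ∈ T, IsPolyhedron c
  nonempty : ∀ c ∈ T, c.Nonempty
  face_mem : ∀ c ∈ T, ∀ F : Set Plane, IsFaceOf F c → F ∈ T
  inter_face : ∀ c ∈ T, ∀ c' ∈ T, (c ∩ c').Nonempty → IsFaceOf (c ∩ c') c ∧ IsFaceOf (c ∩ c') c'

/-- The combinatorial complexity: the total number of (nonempty) faces of all dimensions.
It is only used for complexes, which are finite. -/
def complexity (T : Set (Set Plane)) : ℕ := T.ncard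

/-! ### Lexicographic bottleneck matchings and diagrams -/

/-- The multiset of the lengths of the edges of the matching `σ` for `B + t` and `A`. -/
def edgeLengths {A B : Finset Plane} (σ : ↥B ↪ ↥A) (t : Plane) : Multiset ℝ :=
  Finset.univ.val.map fun b : ↥B => ‖(b : Plane) + t - (σ b : Plane)‖

/-- The lex-bottleneck cost: the vector in `ℝ ^ |B|` of the edge lengths in decreasing order.
The type `Lex (Fin B.card → ℝ)` carries the lexicographic order. -/
def lexCost {A B : Finset Plane} (σ : ↥B ↪ ↥A) (t : Plane) : Lex (Fin B.card → ℝ) :=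
  toLex fun i => ((edgeLengths σ t).sort (· ≥ ·))[(i : ℕ)]'(by
    rw [Multiset.length_sort, edgeLengths, Multiset.card_map, Finset.card_val, Finset.card_univ,
      Fintype.card_coe]
    exact i.isLt)

/-- `T` is a lex-bottleneck diagram for `A` and `B`: a polyhedral complex covering the plane such
that for each face some matching is lexicographically optimal on the whole relative interior. -/
def IsLexBottleneckDiagram (A B : Finset Plane) (T : Set (Set Plane)) : Prop :=
  IsPolyhedralComplex T ∧ ⋃₀ T = Set.univ ∧
    ∀ c ∈ T, ∃ π : ↥B ↪ ↥A, ∀ t ∈ intrinsicInterior ℝ c, ∀ σ : ↥B ↪ ↥A,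
      lexCost π t ≤ lexCost σ t

/-! ### Arrangements of bisectors -/

/-- `s` and `t` lie in the same relatively open face of the arrangement of the lines in `H`:
for each line either both lie on it, or both lie strictly on the same side of it. -/
def SameFace (H : Set (Set Plane)) (s t : Plane) : Prop :=
  ∀ h ∈ H, segment ℝ s t ⊆ h ∨ Disjoint (segment ℝ s t) h

/-- The closed faces, of all dimensions, of the arrangement of the lines in `H`. -/
def arrangement (H : Set (Set Plane)) : Set (Set Plane) :=
  {c | ∃ s : Plane, c = closure {t | SameFace H s t}}

/-- The translations for which the edges `ab` and `a'b'` are equally long. -/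
def bisector (a b a' b' : Plane) : Set Plane :=
  {t | ‖b + t - a‖ = ‖b' + t - a'‖}

/-- All bisectors of `A` and `B` (for pairs of edges with `b - a ≠ b' - a'`, so that the
bisector is a line). -/
def bisectors (A B : Finset Plane) : Set (Set Plane) :=
  {h | ∃ a ∈ A, ∃ b ∈ B, ∃ a' ∈ A, ∃ b' ∈ B, b - a ≠ b' - a' ∧ h = bisector a b a' b'}

/-- The arrangement `lex(A, B)` of all bisectors. -/
def lexArrangement (A B : Finset Plane) : Set (Set Plane) :=
  arrangement (bisectors A B)

/-- The union `Z(t)` of the candidate sets `E_b(t)`, `b ∈ B`. With `k = |B|`, the candidate set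
`E_b(t)` consists of the edges `ab` such that fewer than `k` edges at `b` are strictly shorter than
`ab` at position `t`; that is, it is the smallest set of at least `k` edges at `b` such that each
edge at `b` outside of it is strictly longer than each edge in it. -/
def candidates (A B : Finset Plane) (t : Plane) : Set (Plane × Plane) :=
  {e | e.1 ∈ A ∧ e.2 ∈ B ∧ {a ∈ A | ‖e.2 + t - a‖ < ‖e.2 + t - e.1‖}.card < B.card}

/-- `Z(C)` for a cell `C` of `lex(A, B)`; `Z(t)` is the same for all `t` in the interior. -/
def cellCandidates (A B : Finset Plane) (C : Set Plane) : Set (Plane × Plane) :=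
  {e | ∃ t ∈ interior C, e ∈ candidates A B t}

/-- The cells (two-dimensional faces) of `lex(A, B)`. -/
def IsLexCell (A B : Finset Plane) (C : Set Plane) : Prop :=
  C ∈ lexArrangement A B ∧ (interior C).Nonempty

/-- `F` is an edge (a one-dimensional face) of `lex(A, B)` between the cells `C` and `D`. -/
def IsLexEdge (A B : Finset Plane) (F C D : Set Plane) : Prop :=
  F ∈ lexArrangement A B ∧ Module.finrank ℝ (vectorSpan ℝ F) = 1 ∧
    IsLexCell A B C ∧ IsLexCell A B D ∧ F = C ∩ D

/-- The bisectors used by some edge of `lex(A, B)`: an edge `F` between cells `C` and `D` uses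
`h = h(a, b, a', b')` if `F ⊆ h` and both `ab` and `a'b'` belong to `Z(C) ∪ Z(D)`. -/
def usedBisectors (A B : Finset Plane) : Set (Set Plane) :=
  {h | ∃ a ∈ A, ∃ b ∈ B, ∃ a' ∈ A, ∃ b' ∈ B, b - a ≠ b' - a' ∧ h = bisector a b a' b' ∧
    ∃ F C D : Set Plane, IsLexEdge A B F C D ∧ F ⊆ h ∧
      (a, b) ∈ cellCandidates A B C ∪ cellCandidates A B D ∧
      (a', b') ∈ cellCandidates A B C ∪ cellCandidates A B D}

/-- The arrangement that remains when all unused bisectors are discarded from `lex(A, B)`. -/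
def reducedArrangement (A B : Finset Plane) : Set (Set Plane) :=
  arrangement (usedBisectors A B)

end

/-! At translation `t` the edge `ab` has length `‖t - (a - b)‖`, the distance from `t` to the site
`a - b`, so bisectors are perpendicular bisectors of pairs of sites. The theorem combines a count of
the used bisectors with a proof that the others can be discarded. Write `n = |A|` and `k = |B|`.

Counting: fix `b, b'`, and suppose that an edge `F` uses a bisector of `a - b` and `a' - b'`. At a
relatively interior point of `F` these two sites are equidistant, no other site of `(A - b) ∪ (A -
b')` ties with them, and fewer than `2k` sites are closer. After subtraction of `‖t‖ ^ 2` the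
squared distances are affine in `t`, so such pairs are shallow pairs of at most `2n` affine
functions. A sweep argument bounds the adjacent pairs on a lower envelope linearly
(`card_adjacentPairs_le`). Clarkson--Shor sampling extends this to depth below `2k`
(`card_shallowPairs_le`), which gives `O(nk)` lines for each of the `k ^ 2` pairs `b, b'`.

Correctness: every matching can be improved, edge by edge, to one that uses candidates only
(`exists_matching_mem`), and among those the lexicographic comparison depends only on the order of
the candidates by length (`lexCost_le_of_order_iso`). Crossing a single unused bisector changes
neither the candidates nor their order (`sameCandidateOrder_of_adjacent`). Induction on the number
of separating bisectors extends this to generic points of a cell of the reduced arrangement, and a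
limit argument reaches its lower-dimensional faces (`exists_optimal_on_openFace`).

The complexity follows because faces are determined by sign vectors, of which `m` lines have at most
`2 * m ^ 2 + 1`. -/

noncomputable section

/-! ### Minimization diagrams of affine functions in the plane -/

section MinimizationDiagram

variable {ι : Type*} (α β γ : ι → ℝ)

/-- The affine function with coefficients `α p`, `β p`, `γ p`. -/
def affVal (p : ι) (x y : ℝ) : ℝ := α p * x + β p * y + γ p

/-- `p` attains the minimum over `R` somewhere on the horizontal line at height `y`. -/
def Alive (R : Finset ι) (p : ι) (y : ℝ) : Prop :=
  ∃ x, ∀ r ∈ R, affVal α β γ p x y ≤ affVal α β γ r x y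

/-- At height `y`, the functions `p` and `q` are adjacent on the lower envelope of `R`. -/
def AdjacentAt (R : Finset ι) (p q : ι) (y : ℝ) : Prop :=
  ∃ x, affVal α β γ p x y = affVal α β γ q x y ∧
    ∀ r ∈ R, r ≠ p → r ≠ q → affVal α β γ p x y < affVal α β γ r x y

variable {α β γ} {R : Finset ι}

/-- The region where `p` is minimal is convex, so its projection to the height axis is an interval.
The sweep below rests on this: a function that has died never comes back. -/
theorem Alive.of_mem_Icc {p : ι} {y₁ y y₂ : ℝ} (h₁ : Alive α β γ R p y₁)
    (h₂ : Alive α β γ R p y₂) (hy₁ : y₁ ≤ y) (hy₂ : y ≤ y₂) : Alive α β γ R p y := by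
  rcases eq_or_lt_of_le hy₁ with rfl | hlt
  · exact h₁
  obtain ⟨x₁, h₁⟩ := h₁
  obtain ⟨x₂, h₂⟩ := h₂
  have hpos : 0 < y₂ - y₁ := by linarith
  set c := (y - y₁) / (y₂ - y₁) with hc
  have hc0 : 0 ≤ c := div_nonneg (by linarith) hpos.le
  have hc1 : c ≤ 1 := (div_le_one hpos).2 (by linarith)
  have hy : y = (1 - c) * y₁ + c * y₂ := by
    rw [hc]; field_simp; ring
  refine ⟨(1 - c) * x₁ + c * x₂, fun r hr => ?_⟩
  have e : ∀ q, affVal α β γ q ((1 - c) * x₁ + c * x₂) y =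
      (1 - c) * affVal α β γ q x₁ y₁ + c * affVal α β γ q x₂ y₂ := fun q => by
    simp only [affVal, hy]; ring
  rw [e, e]
  have := mul_le_mul_of_nonneg_left (h₁ r hr) (sub_nonneg.2 hc1)
  have := mul_le_mul_of_nonneg_left (h₂ r hr) hc0
  linarith

theorem AdjacentAt.alive_left {p q : ι} {y : ℝ} (h : AdjacentAt α β γ R p q y) :
    Alive α β γ R p y := by
  obtain ⟨x, h, h'⟩ := h
  refine ⟨x, fun r hr => ?_⟩
  by_cases hp : r = p
  · rw [hp]
  by_cases hq : r = q
  · rw [hq, h]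
  exact (h' r hr hp hq).le

theorem AdjacentAt.alive_right {p q : ι} {y : ℝ} (h : AdjacentAt α β γ R p q y) :
    Alive α β γ R q y := by
  obtain ⟨x, h, h'⟩ := h
  refine ⟨x, fun r hr => ?_⟩
  by_cases hp : r = p
  · rw [hp, h]
  by_cases hq : r = q
  · rw [hq]
  exact h ▸ (h' r hr hp hq).le

/-- At the breakpoint `r` lies strictly above both functions. To the right `q` stays below `r`
because its slope is smaller, and to the left `p` stays below `r` because its slope is larger. -/
theorem AdjacentAt.not_alive {p q r : ι} {y : ℝ} (h : AdjacentAt α β γ R p q y) (hp : p ∈ R)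
    (hq : q ∈ R) (hr : r ∈ R) (hpr : α r < α p) (hrq : α q < α r) : ¬ Alive α β γ R r y := by
  rintro ⟨x', hx'⟩
  obtain ⟨x, h, h'⟩ := h
  have h1 := h' r hr (by rintro rfl; exact lt_irrefl _ hpr) (by rintro rfl; exact lt_irrefl _ hrq)
  have h2 := hx' p hp
  have h3 := hx' q hq
  simp only [affVal] at *
  rcases le_total x x' with hx | hx
  · nlinarith [mul_nonneg (sub_nonneg.2 hx) (sub_pos.2 hrq).le]
  · nlinarith [mul_nonneg (sub_nonneg.2 hx) (sub_pos.2 hpr).le]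

theorem AdjacentAt.le_or_le {p q s : ι} {y : ℝ} (h : AdjacentAt α β γ R p q y) (hp : p ∈ R)
    (hq : q ∈ R) (hs : s ∈ R) (hsy : Alive α β γ R s y) : α p ≤ α s ∨ α s ≤ α q := by
  by_contra! hcon
  exact h.not_alive hp hq hs hcon.1 hcon.2 hsy

theorem AdjacentAt.right_unique (hα : Set.InjOn α R) {p q q' : ι} {y : ℝ}
    (h : AdjacentAt α β γ R p q y) (h' : AdjacentAt α β γ R p q' y) (hp : p ∈ R) (hq : q ∈ R)
    (hq' : q' ∈ R) (hpq : α q < α p) (hpq' : α q' < α p) : q = q' := by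
  apply hα hq hq'
  rcases h.le_or_le hp hq hq' h'.alive_right with h1 | h1
  · linarith
  rcases h'.le_or_le hp hq' hq h.alive_right with h2 | h2
  · linarith
  linarith

theorem AdjacentAt.left_unique (hα : Set.InjOn α R) {p p' q : ι} {y : ℝ}
    (h : AdjacentAt α β γ R p q y) (h' : AdjacentAt α β γ R p' q y) (hp : p ∈ R) (hq : q ∈ R)
    (hp' : p' ∈ R) (hpq : α q < α p) (hpq' : α q < α p') : p = p' := by
  apply hα hp hp'
  rcases h.le_or_le hp hq hp' h'.alive_left with h1 | h1
  · rcases h'.le_or_le hp' hq hp h.alive_left with h2 | h2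
    · linarith
    linarith
  linarith

open Classical in
/-- The pairs that are adjacent on the lower envelope at some height. -/
def adjacentPairs (α β γ : ι → ℝ) (R : Finset ι) : Finset (ι × ι) :=
  {e ∈ R ×ˢ R | α e.2 < α e.1 ∧ ∃ y, AdjacentAt α β γ R e.1 e.2 y}

/-- Linear bound on the number of edges of the minimization diagram. -/
theorem card_adjacentPairs_le (hα : Set.InjOn α R) :
    (adjacentPairs α β γ R).card ≤ 3 * R.card := by
  classical
  set E := adjacentPairs α β γ R with hE
  have hmem : ∀ e ∈ E, e.1 ∈ R ∧ e.2 ∈ R ∧ α e.2 < α e.1 ∧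
      ∃ y, AdjacentAt α β γ R e.1 e.2 y := fun e he => by
    rw [hE, adjacentPairs, Finset.mem_filter, Finset.mem_product] at he
    exact ⟨he.1.1, he.1.2, he.2⟩
  have hy : ∀ e : ι × ι, ∃ y, e ∈ E → AdjacentAt α β γ R e.1 e.2 y := fun e => by
    by_cases he : e ∈ E
    · obtain ⟨y, hy⟩ := (hmem e he).2.2.2
      exact ⟨y, fun _ => hy⟩
    · exact ⟨0, fun h => absurd h he⟩
  choose Y hY using hy
  -- Each pair is charged to a function at most three times in all: to its left member if it is that
  -- member's last chosen adjacency, to its right member likewise, and otherwise to a function that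
  -- later appears between the two.
  set E₁ := E.filter fun e => ∀ e' ∈ E, e'.1 = e.1 → Y e' ≤ Y e with hE₁
  set E₂ := E.filter fun e => ∀ e' ∈ E, e'.2 = e.2 → Y e' ≤ Y e with hE₂
  set E₃ := E.filter fun e => (∃ e' ∈ E, e'.1 = e.1 ∧ Y e < Y e') ∧
    (∃ e' ∈ E, e'.2 = e.2 ∧ Y e < Y e') with hE₃
  have hcover : E ⊆ E₁ ∪ E₂ ∪ E₃ := fun e he => by
    simp only [hE₁, hE₂, hE₃, Finset.mem_union, Finset.mem_filter]
    by_cases h1 : ∀ e' ∈ E, e'.1 = e.1 → Y e' ≤ Y e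
    · exact Or.inl (Or.inl ⟨he, h1⟩)
    by_cases h2 : ∀ e' ∈ E, e'.2 = e.2 → Y e' ≤ Y e
    · exact Or.inl (Or.inr ⟨he, h2⟩)
    push Not at h1 h2
    exact Or.inr ⟨he, h1, h2⟩
  have h₁ : E₁.card ≤ R.card := by
    refine Finset.card_le_card_of_injOn Prod.fst
      (fun e he => (hmem e (Finset.mem_filter.1 he).1).1) ?_
    rintro ⟨p, q⟩ he ⟨p', q'⟩ he' heq
    simp only at heq
    subst heq
    obtain ⟨he, hm⟩ := Finset.mem_filter.1 (Finset.mem_coe.1 he)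
    obtain ⟨he', hm'⟩ := Finset.mem_filter.1 (Finset.mem_coe.1 he')
    have hyy := le_antisymm (hm' _ he rfl) (hm _ he' rfl)
    have a := hY _ he
    have a' := hY _ he'
    rw [← hyy] at a'
    exact Prod.ext rfl (AdjacentAt.right_unique hα a a' (hmem _ he).1 (hmem _ he).2.1
      (hmem _ he').2.1 (hmem _ he).2.2.1 (hmem _ he').2.2.1)
  have h₂ : E₂.card ≤ R.card := by
    refine Finset.card_le_card_of_injOn Prod.snd
      (fun e he => (hmem e (Finset.mem_filter.1 he).1).2.1) ?_
    rintro ⟨p, q⟩ he ⟨p', q'⟩ he' heq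
    simp only at heq
    subst heq
    obtain ⟨he, hm⟩ := Finset.mem_filter.1 (Finset.mem_coe.1 he)
    obtain ⟨he', hm'⟩ := Finset.mem_filter.1 (Finset.mem_coe.1 he')
    have hyy := le_antisymm (hm' _ he rfl) (hm _ he' rfl)
    have a := hY _ he
    have a' := hY _ he'
    rw [← hyy] at a'
    exact Prod.ext (AdjacentAt.left_unique hα a a' (hmem _ he).1 (hmem _ he).2.1
      (hmem _ he').1 (hmem _ he).2.2.1 (hmem _ he').2.2.1) rfl
  have hex : ∀ e ∈ E₃, ∃ r ∈ R, α r < α e.1 ∧ α e.2 < α r ∧ ∃ y₁, Y e < y₁ ∧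
      Alive α β γ R e.1 y₁ ∧ Alive α β γ R e.2 y₁ ∧ Alive α β γ R r y₁ ∧
      ∀ e' ∈ E, Y e < Y e' → Y e' < y₁ → ∀ r' ∈ R, α r' < α e.1 → α e.2 < α r' →
        ¬ Alive α β γ R r' (Y e') := by
    intro e he
    obtain ⟨he, ⟨e', he', h1, hlt⟩, e'', he'', h2, hlt'⟩ := Finset.mem_filter.1 he
    obtain ⟨hp, hq, hpq, -⟩ := hmem e he
    obtain ⟨hp', hq', hpq', -⟩ := hmem e' he'
    obtain ⟨hp'', hq'', hpq'', -⟩ := hmem e'' he''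
    have ae := hY e he
    have ae' := hY e' he'
    have ae'' := hY e'' he''
    set T := E.filter fun f => Y e < Y f ∧ Alive α β γ R e.1 (Y f) ∧ Alive α β γ R e.2 (Y f) ∧
      ∃ r ∈ R, α r < α e.1 ∧ α e.2 < α r ∧ Alive α β γ R r (Y f) with hT
    have hTne : T.Nonempty := by
      -- At the earlier of the two later heights both members of `e` are still alive, while one of
      -- them is adjacent to a third function. That function's slope must lie strictly between
      -- theirs.
      rcases le_total (Y e') (Y e'') with hle | hle
      · have al : Alive α β γ R e.2 (Y e') :=
          ae.alive_right.of_mem_Icc (h2 ▸ ae''.alive_right) hlt.le hle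
        refine ⟨e', Finset.mem_filter.2 ⟨he', hlt, h1 ▸ ae'.alive_left, al, e'.2, hq',
          h1 ▸ hpq', ?_, ae'.alive_right⟩⟩
        rcases ae'.le_or_le hp' hq' hq al with h | h
        · rw [h1] at h; linarith
        · refine lt_of_le_of_ne h fun h => ?_
          have : e = e' := Prod.ext h1.symm (hα hq hq' h)
          rw [this] at hlt
          exact lt_irrefl _ hlt
      · have al : Alive α β γ R e.1 (Y e'') :=
          ae.alive_left.of_mem_Icc (h1 ▸ ae'.alive_left) hlt'.le hle
        refine ⟨e'', Finset.mem_filter.2 ⟨he'', hlt', al, h2 ▸ ae''.alive_right, e''.1, hp'',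
          ?_, h2 ▸ hpq'', ae''.alive_left⟩⟩
        rcases ae''.le_or_le hp'' hq'' hp al with h | h
        · refine lt_of_le_of_ne h fun h => ?_
          have : e = e'' := Prod.ext (hα hp hp'' h.symm) h2.symm
          rw [this] at hlt'
          exact lt_irrefl _ hlt'
        · rw [h2] at h; linarith
    obtain ⟨f, hf, hmin⟩ := T.exists_min_image Y hTne
    obtain ⟨hf, hlt₁, al₁, al₂, r, hr, hr1, hr2, al₃⟩ := Finset.mem_filter.1 hf
    refine ⟨r, hr, hr1, hr2, Y f, hlt₁, al₁, al₂, al₃, fun g hg hg1 hg2 r' hr' h h' hal => ?_⟩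
    have := hmin g (Finset.mem_filter.2 ⟨hg, hg1, ae.alive_left.of_mem_Icc al₁ hg1.le hg2.le,
      ae.alive_right.of_mem_Icc al₂ hg1.le hg2.le, r', hr', h, h', hal⟩)
    linarith
  have h₃ : E₃.card ≤ R.card := by
    have hex' : ∀ e : ι × ι, ∃ r, e ∈ E₃ → r ∈ R ∧ α r < α e.1 ∧ α e.2 < α r ∧ ∃ y₁, Y e < y₁ ∧
      Alive α β γ R e.1 y₁ ∧ Alive α β γ R e.2 y₁ ∧ Alive α β γ R r y₁ ∧
      ∀ e' ∈ E, Y e < Y e' → Y e' < y₁ → ∀ r' ∈ R, α r' < α e.1 → α e.2 < α r' →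
        ¬ Alive α β γ R r' (Y e') := fun e => by
      by_cases he : e ∈ E₃
      · obtain ⟨r, hr⟩ := hex e he
        exact ⟨r, fun _ => hr⟩
      · exact ⟨e.1, fun h => absurd h he⟩
    choose ρ hρ using hex'
    refine Finset.card_le_card_of_injOn ρ (fun e he => (hρ e he).1) ?_
    -- The charged `r` is dead at `Y f` but alive at `y₁` and later than `Y f`, so its interval of
    -- life forces `Y f < y₁`. Before `y₁` nothing lives between the members of `e` at the chosen
    -- heights. Since `r` lies between the members of both pairs, these pairs coincide.
    have key : ∀ e ∈ E₃, ∀ f ∈ E₃, ρ e = ρ f → Y e ≤ Y f → e = f := by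
      intro e he f hf hef hle
      obtain ⟨hr, hr1, hr2, y₁, hy₁, al₁, al₂, al₃, hno⟩ := hρ e he
      obtain ⟨-, hs1, hs2, y₂, hy₂, -, -, bl₃, -⟩ := hρ f hf
      rw [← hef] at hs1 hs2 bl₃
      have he' := (Finset.mem_filter.1 he).1
      have hf' := (Finset.mem_filter.1 hf).1
      obtain ⟨hp, hq, hpq, -⟩ := hmem e he'
      obtain ⟨hs, hu, hsu, -⟩ := hmem f hf'
      have ae := hY e he'
      have af := hY f hf'
      have hnr := af.not_alive hs hu hr hs1 hs2
      have hlt : Y f < y₁ := by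
        by_contra! hcon
        exact hnr (al₃.of_mem_Icc bl₃ hcon hy₂.le)
      have bp : Alive α β γ R e.1 (Y f) := ae.alive_left.of_mem_Icc al₁ hle hlt.le
      have bq : Alive α β γ R e.2 (Y f) := ae.alive_right.of_mem_Icc al₂ hle hlt.le
      have hnone : ∀ r' ∈ R, α r' < α e.1 → α e.2 < α r' → ¬ Alive α β γ R r' (Y f) := by
        rcases eq_or_lt_of_le hle with h | h
        · intro r' hr' h1 h2
          rw [← h]
          exact ae.not_alive hp hq hr' h1 h2
        · exact hno f hf' h hlt
      have c1 : α f.1 ≤ α e.1 := by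
        rcases af.le_or_le hs hu hp bp with h | h
        · exact h
        · linarith
      have c2 : α e.2 ≤ α f.2 := by
        rcases af.le_or_le hs hu hq bq with h | h
        · linarith
        · exact h
      have d1 : α f.1 = α e.1 := by
        refine le_antisymm c1 (le_of_not_gt fun h => ?_)
        exact hnone f.1 hs h (by linarith) af.alive_left
      have d2 : α f.2 = α e.2 := by
        refine le_antisymm (le_of_not_gt fun h => ?_) c2
        exact hnone f.2 hu (by linarith) h af.alive_right
      exact Prod.ext (hα hp hs d1.symm) (hα hq hu d2.symm)
    intro e he f hf hef
    rcases le_total (Y e) (Y f) with h | h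
    · exact key e he f hf hef h
    · exact (key f hf e he hef.symm h).symm
  calc E.card ≤ (E₁ ∪ E₂ ∪ E₃).card := Finset.card_le_card hcover
    _ ≤ E₁.card + E₂.card + E₃.card :=
      (Finset.card_union_le _ _).trans (Nat.add_le_add_right (Finset.card_union_le _ _) _)
    _ ≤ 3 * R.card := by omega

/-! ### Random sampling -/

/-- The probability that a random subset of `S`, containing each element independently with
probability `p`, contains `X` and avoids `I`. -/
theorem sum_weight_filter [DecidableEq ι] (S X I : Finset ι) (hX : X ⊆ S) (hI : I ⊆ S)
    (hXI : Disjoint X I) (p : ℝ) :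
    ∑ R ∈ S.powerset with X ⊆ R ∧ Disjoint R I, p ^ R.card * (1 - p) ^ (S \ R).card =
      p ^ X.card * (1 - p) ^ I.card := by
  -- Expanding this product over subsets `R` gives the sum: a zero factor kills the term unless `X ⊆
  -- R` and `R` avoids `I`.
  have h := Finset.prod_add (fun i => if i ∈ I then 0 else p)
    (fun i => if i ∈ X then 0 else 1 - p) S
  have hl : ∏ i ∈ S, ((if i ∈ I then 0 else p) + (if i ∈ X then 0 else 1 - p)) =
      p ^ X.card * (1 - p) ^ I.card := by
    have : ∀ i ∈ S, ((if i ∈ I then 0 else p) + (if i ∈ X then 0 else 1 - p)) =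
        (if i ∈ X then p else 1) * (if i ∈ I then 1 - p else 1) := fun i _ => by
      by_cases h1 : i ∈ X
      · simp [h1, Finset.disjoint_left.1 hXI h1]
      · by_cases h2 : i ∈ I <;> simp [h1, h2]
    rw [Finset.prod_congr rfl this, Finset.prod_mul_distrib, Finset.prod_ite_mem,
      Finset.prod_ite_mem, Finset.inter_eq_right.2 hX, Finset.inter_eq_right.2 hI]
    simp
  rw [← hl, h, Finset.sum_filter]
  refine Finset.sum_congr rfl fun R hR => ?_
  split_ifs with hc
  · congr 1
    · rw [Finset.prod_congr rfl fun i hi => if_neg (Finset.disjoint_left.1 hc.2 hi)]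
      simp
    · rw [Finset.prod_congr rfl fun i hi => if_neg fun hX => (Finset.mem_sdiff.1 hi).2 (hc.1 hX)]
      simp
  · rw [not_and_or] at hc
    rcases hc with hc | hc
    · obtain ⟨i, hi, hi'⟩ := Finset.not_subset.1 hc
      refine (mul_eq_zero_of_right _ (Finset.prod_eq_zero (Finset.mem_sdiff.2 ⟨hX hi, hi'⟩) ?_)).symm
      exact if_pos hi
    · obtain ⟨i, hi, hi'⟩ := Finset.not_disjoint_iff.1 hc
      refine (mul_eq_zero_of_left (Finset.prod_eq_zero hi ?_) _).symm
      exact if_pos hi'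

open Classical in
/-- The pairs that, at some point with no further ties, have fewer than `j` functions below them. -/
def shallowPairs (α β γ : ι → ℝ) (S : Finset ι) (j : ℕ) : Finset (ι × ι) :=
  {e ∈ S ×ˢ S | α e.2 < α e.1 ∧ ∃ x y, affVal α β γ e.1 x y = affVal α β γ e.2 x y ∧
    (∀ r ∈ S, r ≠ e.1 → r ≠ e.2 → affVal α β γ r x y ≠ affVal α β γ e.1 x y) ∧
    {r ∈ S | affVal α β γ r x y < affVal α β γ e.1 x y}.card < j}

/-- The Clarkson--Shor bound on the number of shallow pairs. -/
theorem card_shallowPairs_le (hα : Set.InjOn α R) {j : ℕ} (hj : 0 < j) :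
    (shallowPairs α β γ R j).card ≤ 12 * (j * R.card) := by
  classical
  -- With this sampling rate, Bernoulli's inequality shows that all of the fewer than `j` lower
  -- functions are missed with probability at least `1 / 2`. A shallow pair therefore becomes
  -- adjacent in the sample with probability at least `p ^ 2 / 2`, while the expected number of
  -- adjacent pairs is at most `3 * p * |R|`.
  set p : ℝ := 1 / (2 * j) with hp
  have hj' : (1 : ℝ) ≤ j := by exact_mod_cast hj
  have hp0 : 0 < p := by positivity
  have hjp : j * p = 1 / 2 := by rw [hp]; field_simp
  have hp1 : p ≤ 1 / 2 := by nlinarith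
  set w : Finset ι → ℝ := fun Q => p ^ Q.card * (1 - p) ^ (R \ Q).card with hw
  have hw0 : ∀ Q, 0 ≤ w Q := fun Q =>
    mul_nonneg (pow_nonneg hp0.le _) (pow_nonneg (by linarith) _)
  have hup : ∑ Q ∈ R.powerset, w Q * (adjacentPairs α β γ Q).card ≤ 3 * (p * R.card) := by
    calc ∑ Q ∈ R.powerset, w Q * (adjacentPairs α β γ Q).card
        ≤ ∑ Q ∈ R.powerset, w Q * (3 * Q.card) := by
          refine Finset.sum_le_sum fun Q hQ => mul_le_mul_of_nonneg_left ?_ (hw0 Q)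
          exact_mod_cast card_adjacentPairs_le
            (hα.mono (Finset.coe_subset.2 (Finset.mem_powerset.1 hQ)))
      _ = 3 * ∑ Q ∈ R.powerset, ∑ i ∈ R, if i ∈ Q then w Q else 0 := by
          rw [Finset.mul_sum]
          refine Finset.sum_congr rfl fun Q hQ => ?_
          rw [Finset.sum_ite_mem, Finset.inter_eq_right.2 (Finset.mem_powerset.1 hQ),
            Finset.sum_const, nsmul_eq_mul]
          ring
      _ = 3 * (p * R.card) := by
          rw [Finset.sum_comm]
          congr 1
          have : ∀ i ∈ R, ∑ Q ∈ R.powerset, (if i ∈ Q then w Q else 0) = p := fun i hi => by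
            have := sum_weight_filter R {i} ∅ (Finset.singleton_subset_iff.2 hi)
              (Finset.empty_subset _) (Finset.disjoint_empty_right _) p
            simpa [Finset.sum_filter] using this
          rw [Finset.sum_congr rfl this, Finset.sum_const, nsmul_eq_mul, mul_comm]
  have hlow : (shallowPairs α β γ R j).card * (p ^ 2 / 2) ≤
      ∑ Q ∈ R.powerset, w Q * (adjacentPairs α β γ Q).card := by
    calc (shallowPairs α β γ R j).card * (p ^ 2 / 2)
        ≤ ∑ e ∈ shallowPairs α β γ R j, ∑ Q ∈ R.powerset,
            if e ∈ adjacentPairs α β γ Q then w Q else 0 := by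
          rw [← nsmul_eq_mul]
          refine Finset.card_nsmul_le_sum _ _ _ fun e he => ?_
          rw [shallowPairs, Finset.mem_filter, Finset.mem_product] at he
          obtain ⟨⟨h1, h2⟩, hlt, x, y, heq, hne, hcard⟩ := he
          set I := R.filter fun r => affVal α β γ r x y < affVal α β γ e.1 x y with hI
          have hne12 : e.1 ≠ e.2 := fun h => by rw [h] at hlt; exact lt_irrefl _ hlt
          have hd : Disjoint ({e.1, e.2} : Finset ι) I := by
            rw [Finset.disjoint_left]
            intro i hi hi'
            have := (Finset.mem_filter.1 hi').2
            rcases Finset.mem_insert.1 hi with rfl | hi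
            · exact lt_irrefl _ this
            · rw [Finset.mem_singleton.1 hi, heq] at this
              exact lt_irrefl _ this
          have hs := sum_weight_filter R {e.1, e.2} I
            (by intro i hi
                rcases Finset.mem_insert.1 hi with rfl | hi
                · exact h1
                · rw [Finset.mem_singleton.1 hi]; exact h2) (Finset.filter_subset _ _) hd p
          rw [Finset.card_pair hne12] at hs
          have hbern : 1 / 2 ≤ (1 - p) ^ I.card := by
            have h := one_add_mul_le_pow (a := -p) (by linarith) I.card
            have hc : (I.card : ℝ) * p ≤ j * p :=
              mul_le_mul_of_nonneg_right (by exact_mod_cast hcard.le) hp0.le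
            calc (1 : ℝ) / 2 ≤ 1 + I.card * -p := by linarith
              _ ≤ _ := by rw [sub_eq_add_neg]; exact h
          calc p ^ 2 / 2 ≤ p ^ 2 * (1 - p) ^ I.card := by nlinarith [sq_nonneg p]
            _ = _ := hs.symm
            _ ≤ _ := by
              rw [Finset.sum_filter]
              refine Finset.sum_le_sum fun Q hQ => ?_
              by_cases hc : {e.1, e.2} ⊆ Q ∧ Disjoint Q I
              · rw [if_pos hc, if_pos]
                rw [adjacentPairs, Finset.mem_filter, Finset.mem_product]
                refine ⟨⟨hc.1 (by simp), hc.1 (by simp)⟩, hlt, y, x, heq, fun r hr hr1 hr2 => ?_⟩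
                have hrR := Finset.mem_powerset.1 hQ hr
                refine lt_of_le_of_ne (le_of_not_gt fun h => ?_) (hne r hrR hr1 hr2).symm
                exact Finset.disjoint_left.1 hc.2 hr (Finset.mem_filter.2 ⟨hrR, h⟩)
              · rw [if_neg hc]
                split_ifs
                · exact hw0 Q
                · exact le_rfl
      _ = ∑ Q ∈ R.powerset, ∑ e ∈ shallowPairs α β γ R j,
            if e ∈ adjacentPairs α β γ Q then w Q else 0 := Finset.sum_comm
      _ ≤ _ := by
          refine Finset.sum_le_sum fun Q _ => ?_
          rw [Finset.sum_ite_mem, Finset.sum_const, nsmul_eq_mul, mul_comm]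
          refine mul_le_mul_of_nonneg_left ?_ (hw0 Q)
          exact_mod_cast Finset.card_le_card Finset.inter_subset_right
  have hfin : ((shallowPairs α β γ R j).card : ℝ) * p ≤ 6 * R.card := by
    have := hlow.trans hup
    nlinarith
  have : ((shallowPairs α β γ R j).card : ℝ) ≤ 12 * (j * R.card) := by
    have h2 : (0 : ℝ) ≤ 2 * j := by positivity
    have := mul_le_mul_of_nonneg_right hfin h2
    have e : ((shallowPairs α β γ R j).card : ℝ) * p * (2 * j) =
      (shallowPairs α β γ R j).card * (2 * (j * p)) := by ring
    rw [e, hjp] at this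
    linarith
  exact_mod_cast this

end MinimizationDiagram
end

noncomputable section

/-! ### Comparison of lexicographic costs -/

/-- Describing sorted entries by counts removes the sorting from comparisons: counts above a
threshold are visibly monotone in the individual edge lengths. -/
theorem le_getElem_iff_lt_countP {l : List ℝ} (hl : l.Pairwise (· ≥ ·)) (v : ℝ) (i : ℕ)
    (hi : i < l.length) : v ≤ l[i] ↔ i < l.countP (fun x => decide (v ≤ x)) := by
  induction l generalizing i with
  | nil => simp at hi
  | cons x l ih =>
    rw [List.pairwise_cons] at hl
    rw [List.countP_cons]
    by_cases hx : v ≤ x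
    · cases i with
      | zero => simp [hx]
      | succ i =>
        have := ih hl.2 i (by simpa using hi)
        simp [hx, this]
    · have h0 : l.countP (fun x => decide (v ≤ x)) = 0 := by
        rw [List.countP_eq_zero]
        intro y hy
        have := hl.1 y hy
        simp only [decide_eq_true_eq, not_le]
        exact lt_of_le_of_lt this (not_le.1 hx)
      cases i with
      | zero => simp [hx, h0]
      | succ i =>
        simp only [List.getElem_cons_succ, h0, hx, decide_false]
        have := ih hl.2 i (by simpa using hi)
        rw [h0] at this
        simpa using this

variable {A B : Finset Plane}

theorem length_sort_edgeLengths (σ : ↥B ↪ ↥A) (t : Plane) :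
    ((edgeLengths σ t).sort (· ≥ ·)).length = B.card := by
  rw [Multiset.length_sort, edgeLengths, Multiset.card_map, Finset.card_val, Finset.card_univ,
      Fintype.card_coe]

theorem lexCost_le_of_forall_le {σ τ : ↥B ↪ ↥A} {t : Plane}
    (h : ∀ b : ↥B, ‖(b : Plane) + t - (σ b : Plane)‖ ≤ ‖(b : Plane) + t - (τ b : Plane)‖) :
    lexCost σ t ≤ lexCost τ t := by
  apply Pi.toLex_monotone
  intro i
  simp only
  rw [le_getElem_iff_lt_countP (Multiset.pairwise_sort _ _)]
  set v := ((edgeLengths σ t).sort (· ≥ ·))[(i : ℕ)]'(by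
    rw [length_sort_edgeLengths]; exact i.isLt) with hv
  have h1 := (le_getElem_iff_lt_countP (Multiset.pairwise_sort (edgeLengths σ t) (· ≥ ·)) v i
    (by rw [length_sort_edgeLengths]; exact i.isLt)).1 hv.le
  refine h1.trans_le ?_
  have e : ∀ m : Multiset ℝ, (m.sort (· ≥ ·)).countP (fun x => decide (v ≤ x)) =
      m.countP (fun x => v ≤ x) := fun m => by
    conv_rhs => rw [← Multiset.sort_eq m (· ≥ ·)]
    rw [Multiset.coe_countP]
  rw [e, e, edgeLengths, edgeLengths, Multiset.countP_map, Multiset.countP_map]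
  apply Multiset.card_le_card
  exact Multiset.monotone_filter_right _ fun b hb => hb.trans (h b)

/-- The cost comparison is preserved when the order of the edge lengths is preserved. -/
theorem lexCost_le_of_order_iso {σ τ : ↥B ↪ ↥A} {s t : Plane} (Z : Set (Plane × Plane))
    (hσ : ∀ b : ↥B, ((σ b : Plane), (b : Plane)) ∈ Z)
    (hτ : ∀ b : ↥B, ((τ b : Plane), (b : Plane)) ∈ Z)
    (hZ : ∀ e ∈ Z, ∀ e' ∈ Z, ‖e.2 + s - e.1‖ ≤ ‖e'.2 + s - e'.1‖ ↔
      ‖e.2 + t - e.1‖ ≤ ‖e'.2 + t - e'.1‖)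
    (h : lexCost σ s ≤ lexCost τ s) : lexCost σ t ≤ lexCost τ t := by
  classical
  -- Edges of `Z` with equal length at `s` have equal length at `t`, so the length at `t` is a
  -- function of the length at `s`. Its value `0` elsewhere plays no role. As `f` is strictly
  -- increasing on the lengths that occur, it commutes with sorting.
  obtain ⟨f, hfe⟩ : ∃ f : ℝ → ℝ, ∀ e ∈ Z, f ‖e.2 + s - e.1‖ = ‖e.2 + t - e.1‖ := by
    refine ⟨fun v => if hv : ∃ e ∈ Z, ‖e.2 + s - e.1‖ = v then
      ‖hv.choose.2 + t - hv.choose.1‖ else 0, fun e he => ?_⟩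
    have hv : ∃ e' ∈ Z, ‖e'.2 + s - e'.1‖ = ‖e.2 + s - e.1‖ := ⟨e, he, rfl⟩
    beta_reduce
    rw [dif_pos hv]
    obtain ⟨h1, h2⟩ := hv.choose_spec
    exact le_antisymm ((hZ _ h1 _ he).1 h2.le) ((hZ _ he _ h1).1 h2.ge)
  set V : Set ℝ := {v | ∃ e ∈ Z, ‖e.2 + s - e.1‖ = v} with hV
  have hmono : StrictMonoOn f V := by
    rintro _ ⟨e, he, rfl⟩ _ ⟨e', he', rfl⟩ hlt
    rw [hfe e he, hfe e' he']
    by_contra! hcon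
    exact absurd ((hZ _ he' _ he).2 hcon) (not_le.2 hlt)
  have hmem : ∀ ρ : ↥B ↪ ↥A, (∀ b : ↥B, ((ρ b : Plane), (b : Plane)) ∈ Z) →
      ∀ v ∈ (edgeLengths ρ s).sort (· ≥ ·), v ∈ V := fun ρ hρ v hv => by
    rw [Multiset.mem_sort, edgeLengths, Multiset.mem_map] at hv
    obtain ⟨b, -, rfl⟩ := hv
    exact ⟨((ρ b : Plane), (b : Plane)), hρ b, rfl⟩
  have hsort : ∀ ρ : ↥B ↪ ↥A, (∀ b : ↥B, ((ρ b : Plane), (b : Plane)) ∈ Z) →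
      (edgeLengths ρ t).sort (· ≥ ·) = ((edgeLengths ρ s).sort (· ≥ ·)).map f := by
    intro ρ hρ
    have hp : ((edgeLengths ρ s).sort (· ≥ ·)).map f = (edgeLengths ρ t).sort (· ≥ ·) := by
      apply List.Perm.eq_of_pairwise' (r := (· ≥ ·)) 
      · rw [List.pairwise_map]
        refine (Multiset.pairwise_sort (edgeLengths ρ s) (· ≥ ·)).imp_of_mem
          fun {x y} ha hb hab => ?_
        have hyx : y ≤ x := hab
        exact hmono.monotoneOn (hmem ρ hρ y hb) (hmem ρ hρ x ha) hyx
      · exact Multiset.pairwise_sort _ _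
      · rw [← Multiset.coe_eq_coe, ← Multiset.map_coe, Multiset.sort_eq, Multiset.sort_eq,
          edgeLengths, edgeLengths, Multiset.map_map]
        refine Multiset.map_congr rfl fun b _ => ?_
        exact hfe ((ρ b : Plane), (b : Plane)) (hρ b)
    exact hp.symm
  have hval : ∀ ρ : ↥B ↪ ↥A, (∀ b : ↥B, ((ρ b : Plane), (b : Plane)) ∈ Z) →
      ∀ i, ofLex (lexCost ρ s) i ∈ V ∧ ofLex (lexCost ρ t) i = f (ofLex (lexCost ρ s) i) := by
    intro ρ hρ i
    refine ⟨hmem ρ hρ _ (List.getElem_mem _), ?_⟩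
    simp only [lexCost, ofLex_toLex]
    simp only [hsort ρ hρ, List.getElem_map]
  rcases h.lt_or_eq with h | h
  · obtain ⟨i, hi, hlt⟩ := h
    refine le_of_lt ⟨i, fun j hj => ?_, ?_⟩
    · have := hi j hj
      rw [show lexCost σ t j = _ from (hval σ hσ j).2, show lexCost τ t j = _ from (hval τ hτ j).2]
      exact congrArg f this
    · rw [show lexCost σ t i = _ from (hval σ hσ i).2, show lexCost τ t i = _ from (hval τ hτ i).2]
      exact hmono (hval σ hσ i).1 (hval τ hτ i).1 hlt
  · refine le_of_eq (funext fun j => ?_)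
    rw [show lexCost σ t j = _ from (hval σ hσ j).2, show lexCost τ t j = _ from (hval τ hτ j).2]
    rw [h]

/-- Any matching can be improved, edge by edge, to a matching inside `Z`, provided that `Z`
contains at least `|B|` edges at each `b`, none longer than any edge at `b` outside of `Z`. -/
theorem exists_matching_mem (σ : ↥B ↪ ↥A) (t : Plane) (Z : Set (Plane × Plane))
    (hcard : ∀ b ∈ B, ∃ Q : Finset Plane, Q ⊆ A ∧ B.card ≤ Q.card ∧ ∀ a ∈ Q, (a, b) ∈ Z)
    (hle : ∀ b ∈ B, ∀ a ∈ A, ∀ a' ∈ A, (a, b) ∈ Z → (a', b) ∉ Z →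
      ‖b + t - a‖ ≤ ‖b + t - a'‖) :
    ∃ τ : ↥B ↪ ↥A, (∀ b : ↥B, ((τ b : Plane), (b : Plane)) ∈ Z) ∧
      ∀ b : ↥B, ‖(b : Plane) + t - (τ b : Plane)‖ ≤ ‖(b : Plane) + t - (σ b : Plane)‖ := by
  classical
  -- Among the edgewise improvements of `σ`, take one with the most edges in `Z`. If the edge at `b`
  -- is not in `Z`, the other `|B| - 1` points cannot occupy all candidates at `b`, and rerouting
  -- `b` to a free one contradicts maximality.
  set S : Finset (↥B ↪ ↥A) := Finset.univ.filter fun τ =>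
    ∀ b : ↥B, ‖(b : Plane) + t - (τ b : Plane)‖ ≤ ‖(b : Plane) + t - (σ b : Plane)‖ with hS
  obtain ⟨τ, hτ, hmax⟩ := S.exists_max_image
    (fun τ => (Finset.univ.filter fun b : ↥B => ((τ b : Plane), (b : Plane)) ∈ Z).card)
    ⟨σ, Finset.mem_filter.2 ⟨Finset.mem_univ _, fun _ => le_rfl⟩⟩
  have hτ' := (Finset.mem_filter.1 hτ).2
  refine ⟨τ, ?_, hτ'⟩
  by_contra! hcon
  obtain ⟨b, hb⟩ := hcon
  obtain ⟨Q, hQA, hQ, hQZ⟩ := hcard b b.2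
  obtain ⟨a, haQ, ha⟩ : ∃ a ∈ Q, ∀ b' : ↥B, b' ≠ b → (τ b' : Plane) ≠ a := by
    by_contra! hall
    have : Q ⊆ (Finset.univ.erase b).image fun b' => (τ b' : Plane) := fun a ha => by
      obtain ⟨b', h1, h2⟩ := hall a ha
      exact Finset.mem_image.2 ⟨b', Finset.mem_erase.2 ⟨h1, Finset.mem_univ _⟩, h2⟩
    have h1 := (Finset.card_le_card this).trans Finset.card_image_le
    rw [Finset.card_erase_of_mem (Finset.mem_univ _), Finset.card_univ, Fintype.card_coe] at h1
    have : 0 < B.card := Finset.card_pos.2 ⟨b, b.2⟩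
    omega
  have hinj : Function.Injective (Function.update τ b ⟨a, hQA haQ⟩) := by
    intro x y hxy
    by_cases hx : x = b
    · by_cases hy : y = b
      · rw [hx, hy]
      · rw [hx, Function.update_self, Function.update_of_ne hy] at hxy
        exact absurd (congrArg Subtype.val hxy.symm) (ha y hy)
    · by_cases hy : y = b
      · rw [hy, Function.update_self, Function.update_of_ne hx] at hxy
        exact absurd (congrArg Subtype.val hxy) (ha x hx)
      · rw [Function.update_of_ne hx, Function.update_of_ne hy] at hxy
        exact τ.injective hxy
  have hmem : (⟨_, hinj⟩ : ↥B ↪ ↥A) ∈ S := by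
    refine Finset.mem_filter.2 ⟨Finset.mem_univ _, fun x => ?_⟩
    simp only [Function.Embedding.coeFn_mk]
    by_cases hx : x = b
    · subst hx
      rw [Function.update_self]
      exact (hle x x.2 a (hQA haQ) _ (τ x).2 (hQZ a haQ) hb).trans (hτ' x)
    · rw [Function.update_of_ne hx]
      exact hτ' x
  refine absurd (hmax _ hmem) (not_le.2 (Finset.card_lt_card ?_))
  rw [Finset.ssubset_iff_of_subset]
  · refine ⟨b, ?_, fun h => hb (Finset.mem_filter.1 h).2⟩
    simp only [Finset.mem_filter, Finset.mem_univ, true_and, Function.Embedding.coeFn_mk,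
      Function.update_self]
    exact hQZ a haQ
  · intro x hx
    have hx' := (Finset.mem_filter.1 hx).2
    have hxb : x ≠ b := fun h => hb (h ▸ hx')
    simp only [Finset.mem_filter, Finset.mem_univ, true_and, Function.Embedding.coeFn_mk,
      Function.update_of_ne hxb]
    exact hx'

end

noncomputable section

/-! ### Sign vectors of affine functions in the plane -/

section SignVectors

variable {κ : Type*} (f : κ → Plane →ᵃ[ℝ] ℝ) (H : Set κ)

/-- The points with the same signs as `s`. -/
def openFace (s : Plane) : Set Plane :=
  {t | ∀ h ∈ H, SignType.sign (f h s) = SignType.sign (f h t)}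

/-- The points with weakly the same signs as `s`. -/
def closedFace (s : Plane) : Set Plane :=
  {t | ∀ h ∈ H, (0 ≤ f h s → 0 ≤ f h t) ∧ (f h s ≤ 0 → f h t ≤ 0)}

theorem continuous_affine (g : Plane →ᵃ[ℝ] ℝ) : Continuous g :=
  g.continuous_of_finiteDimensional

theorem affine_lineMap (g : Plane →ᵃ[ℝ] ℝ) (x y : Plane) (c : ℝ) :
    g (AffineMap.lineMap x y c) = (1 - c) * g x + c * g y := by
  rw [AffineMap.apply_lineMap, AffineMap.lineMap_apply_ring]

theorem continuous_lineMap_plane (x y : Plane) :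
    Continuous fun c : ℝ => (AffineMap.lineMap x y c : Plane) :=
  AffineMap.lineMap_continuous

variable {f H}

theorem mem_openFace_self (s : Plane) : s ∈ openFace f H s := fun _ _ => rfl

theorem openFace_subset_closedFace (s : Plane) : openFace f H s ⊆ closedFace f H s := by
  intro t ht h hh
  have := ht h hh
  exact ⟨fun h0 => sign_nonneg_iff.1 (this ▸ sign_nonneg_iff.2 h0),
    fun h0 => sign_nonpos_iff.1 (this ▸ sign_nonpos_iff.2 h0)⟩

theorem mem_closedFace_self (s : Plane) : s ∈ closedFace f H s :=
  openFace_subset_closedFace s (mem_openFace_self s)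

theorem isClosed_closedFace (s : Plane) : IsClosed (closedFace f H s) := by
  have : closedFace f H s = ⋂ h ∈ H, ({t | 0 ≤ f h s → 0 ≤ f h t} ∩
      {t | f h s ≤ 0 → f h t ≤ 0}) := by
    ext t; simp [closedFace]
  rw [this]
  refine isClosed_biInter fun h _ => IsClosed.inter ?_ ?_
  · by_cases h0 : 0 ≤ f h s
    · simpa [h0] using isClosed_le continuous_const (continuous_affine (f h))
    · simp [h0]
  · by_cases h0 : f h s ≤ 0
    · simpa [h0] using isClosed_le (continuous_affine (f h)) continuous_const
    · simp [h0]

theorem closedFace_trans {s t x : Plane} (ht : t ∈ closedFace f H s)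
    (hx : x ∈ closedFace f H t) : x ∈ closedFace f H s := fun h hh =>
  ⟨fun h0 => (hx h hh).1 ((ht h hh).1 h0), fun h0 => (hx h hh).2 ((ht h hh).2 h0)⟩

theorem lineMap_mem_openFace {s x : Plane} (hx : x ∈ closedFace f H s) {c : ℝ} (hc0 : 0 < c)
    (hc1 : c ≤ 1) : AffineMap.lineMap x s c ∈ openFace f H s := by
  intro h hh
  have h1 := hx h hh
  rw [affine_lineMap]
  rcases lt_trichotomy (f h s) 0 with h0 | h0 | h0
  · rw [sign_neg h0, sign_neg]
    nlinarith [mul_nonneg (sub_nonneg.2 hc1) (neg_nonneg.2 (h1.2 h0.le))]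
  · have : f h x = 0 := le_antisymm (h1.2 h0.le) (h1.1 h0.ge)
    simp [h0, this]
  · rw [sign_pos h0, sign_pos]
    nlinarith [mul_nonneg (sub_nonneg.2 hc1) (h1.1 h0.le)]

theorem closure_openFace (s : Plane) : closure (openFace f H s) = closedFace f H s := by
  refine (closure_minimal (openFace_subset_closedFace s) (isClosed_closedFace s)).antisymm ?_
  intro x hx
  have ht : Filter.Tendsto (fun c : ℝ => (AffineMap.lineMap x s c : Plane))
      (nhdsWithin 0 (Set.Ioi 0)) (nhds x) := by
    have := (continuous_lineMap_plane x s).tendsto 0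
    rw [AffineMap.lineMap_apply_zero] at this
    exact this.mono_left nhdsWithin_le_nhds
  refine mem_closure_of_tendsto ht ?_
  filter_upwards [Ioc_mem_nhdsGT (zero_lt_one' ℝ)] with c hc
  exact lineMap_mem_openFace hx hc.1 hc.2

theorem convex_closedFace (s : Plane) : Convex ℝ (closedFace f H s) := by
  intro x hx y hy a b ha hb hab h hh
  have e : f h (a • x + b • y) = a * f h x + b * f h y := by
    have : a • x + b • y = AffineMap.lineMap x y b := by
      rw [AffineMap.lineMap_apply_module, ← hab]; congr 2; ring
    rw [this, affine_lineMap, ← hab]; ring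
  rw [e]
  have h1 := hx h hh
  have h2 := hy h hh
  constructor
  · intro h0
    have := mul_nonneg ha (h1.1 h0)
    have := mul_nonneg hb (h2.1 h0)
    linarith
  · intro h0
    have := mul_nonneg ha (neg_nonneg.2 (h1.2 h0))
    have := mul_nonneg hb (neg_nonneg.2 (h2.2 h0))
    linarith

theorem eventually_sign_eq {g : Plane →ᵃ[ℝ] ℝ} {x : Plane} (hx : g x ≠ 0) :
    ∀ᶠ y in nhds x, SignType.sign (g x) = SignType.sign (g y) := by
  rcases lt_or_gt_of_ne hx with h | h
  · filter_upwards [(continuous_affine g).continuousAt.eventually_lt continuousAt_const h] with y hy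
    rw [sign_neg h, sign_neg hy]
  · filter_upwards [continuousAt_const.eventually_lt (continuous_affine g).continuousAt h] with y hy
    rw [sign_pos h, sign_pos hy]

/-- The points of a closed face lie on segments that can be prolonged beyond the base point. -/
theorem exists_lineMap_mem_openFace (hH : H.Finite) {s x : Plane} (hx : x ∈ closedFace f H s) :
    ∃ ε > (0 : ℝ), (AffineMap.lineMap x s (1 + ε) : Plane) ∈ openFace f H s := by
  have hev : ∀ᶠ ε in nhdsWithin (0 : ℝ) (Set.Ioi 0),
      (AffineMap.lineMap x s (1 + ε) : Plane) ∈ openFace f H s := by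
    refine (Filter.eventually_all_finite hH).2 fun h hh => ?_
    by_cases h0 : f h s = 0
    · refine Filter.Eventually.of_forall fun ε => ?_
      have := hx h hh
      have : f h x = 0 := le_antisymm (this.2 h0.le) (this.1 h0.ge)
      rw [affine_lineMap, h0, this]; simp
    · have hc : Continuous fun ε : ℝ => (AffineMap.lineMap x s (1 + ε) : Plane) :=
        (continuous_lineMap_plane x s).comp (continuous_const.add continuous_id)
      have := hc.tendsto 0
      rw [add_zero, AffineMap.lineMap_apply_one] at this
      exact (this.mono_left nhdsWithin_le_nhds).eventually (eventually_sign_eq h0)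
  obtain ⟨ε, h1, h2⟩ := (hev.and self_mem_nhdsWithin).exists
  exact ⟨ε, h2, h1⟩

/-- From a relatively interior `t` the segment from `s` can be prolonged a little inside the closed
face. A form that is nonzero at `s` and zero at `t` would change sign there. -/
theorem intrinsicInterior_closedFace_subset (s : Plane) :
    intrinsicInterior ℝ (closedFace f H s) ⊆ openFace f H s := by
  rintro _ ⟨⟨t, htS⟩, ht, rfl⟩
  have hs : s ∈ affineSpan ℝ (closedFace f H s) := subset_affineSpan ℝ _ (mem_closedFace_self s)
  have hmem : ∀ c : ℝ, (AffineMap.lineMap s t c : Plane) ∈ affineSpan ℝ (closedFace f H s) :=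
    fun c => AffineMap.lineMap_mem c hs htS
  have hc : Continuous fun ε : ℝ =>
      (⟨AffineMap.lineMap s t (1 + ε), hmem _⟩ : affineSpan ℝ (closedFace f H s)) :=
    Continuous.subtype_mk ((continuous_lineMap_plane s t).comp
      (continuous_const.add continuous_id)) _
  have h0 : (⟨AffineMap.lineMap s t (1 + (0 : ℝ)), hmem _⟩ : affineSpan ℝ (closedFace f H s)) =
      ⟨t, htS⟩ := Subtype.ext (by simp)
  have hev := hc.tendsto 0
  rw [h0] at hev
  have hev' := hev.eventually (mem_interior_iff_mem_nhds.1 ht)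
  obtain ⟨ε, h1, h2⟩ := ((hev'.filter_mono (nhdsWithin_le_nhds (s := Set.Ioi 0))).and
    self_mem_nhdsWithin).exists
  have h1 : (AffineMap.lineMap s t (1 + ε) : Plane) ∈ closedFace f H s := h1
  have h2 : 0 < ε := h2
  have htc : (⟨t, htS⟩ : affineSpan ℝ (closedFace f H s)) ∈
      (Subtype.val ⁻¹' closedFace f H s : Set (affineSpan ℝ (closedFace f H s))) :=
    interior_subset ht
  replace htc : t ∈ closedFace f H s := htc
  intro h hh
  have a := h1 h hh
  have b := htc h hh
  rw [affine_lineMap] at a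
  simp only
  rcases lt_trichotomy (f h s) 0 with h0 | h0 | h0
  · have := a.2 h0.le
    have := b.2 h0.le
    rw [sign_neg h0, sign_neg]
    nlinarith [mul_pos h2 (neg_pos.2 h0)]
  · rw [h0, le_antisymm (b.2 h0.le) (b.1 h0.ge)]
  · have := a.1 h0.le
    have := b.1 h0.le
    rw [sign_pos h0, sign_pos]
    nlinarith [mul_pos h2 h0]

/-- An affine function that is nonnegative on a closed face vanishes nowhere or everywhere on the
open face. -/
theorem eq_zero_of_nonneg (hH : H.Finite) {s t u : Plane} {g : Plane →ᵃ[ℝ] ℝ}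
    (hg : ∀ x ∈ openFace f H s, 0 ≤ g x) (ht : t ∈ openFace f H s) (hu : u ∈ openFace f H s)
    (h0 : g t = 0) : g u = 0 := by
  have e : openFace f H t = openFace f H s := by
    ext x
    exact ⟨fun hx h hh => (ht h hh).trans (hx h hh), fun hx h hh => (ht h hh).symm.trans (hx h hh)⟩
  have hu' : u ∈ closedFace f H t := openFace_subset_closedFace t (e ▸ hu)
  -- Just beyond `t` on the ray from `u`, the value of `g` is `-ε * g u`, so `g u` cannot be
  -- positive.
  obtain ⟨ε, hε, hmem⟩ := exists_lineMap_mem_openFace hH hu'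
  have := hg _ (e ▸ hmem)
  rw [affine_lineMap, h0] at this
  have := hg u hu
  nlinarith

/-! ### The polyhedral complex of closed faces -/

theorem affine_eq (g : Plane →ᵃ[ℝ] ℝ) (x : Plane) :
    g x = LinearMap.toContinuousLinearMap g.linear x + g 0 := by
  conv_lhs => rw [g.decomp]
  simp

theorem isPolyhedron_closedFace (hH : H.Finite) (s : Plane) :
    IsPolyhedron (closedFace f H s) := by
  classical
  refine ⟨((hH.toFinset.filter fun h => 0 ≤ f h s).image
      fun h => (-LinearMap.toContinuousLinearMap (f h).linear, f h 0)) ∪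
    ((hH.toFinset.filter fun h => f h s ≤ 0).image
      fun h => (LinearMap.toContinuousLinearMap (f h).linear, -f h 0)), ?_⟩
  ext x
  simp only [closedFace, Set.mem_ofPred_eq, Finset.mem_union, Finset.mem_image, Finset.mem_filter,
    Set.Finite.mem_toFinset]
  constructor
  · rintro hx _ (⟨h, ⟨hh, h0⟩, rfl⟩ | ⟨h, ⟨hh, h0⟩, rfl⟩)
    · have := (hx h hh).1 h0
      rw [affine_eq] at this
      simp only [neg_apply] at *
      linarith
    · have := (hx h hh).2 h0
      rw [affine_eq] at this
      linarith
  · intro hx h hh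
    constructor
    · intro h0
      have := hx _ (Or.inl ⟨h, ⟨hh, h0⟩, rfl⟩)
      rw [affine_eq]
      simp only [neg_apply] at *
      linarith
    · intro h0
      have := hx _ (Or.inr ⟨h, ⟨hh, h0⟩, rfl⟩)
      rw [affine_eq]
      simp only at *
      linarith

theorem exists_eq_closedFace_of_isFaceOf (hH : H.Finite) {s : Plane} {F : Set Plane}
    (hF : IsFaceOf F (closedFace f H s)) : ∃ z, F = closedFace f H z := by
  classical
  obtain ⟨l, hl⟩ := hF.2 hF.1
  -- A point of `F` on as few lines as possible plays the role of a relatively interior point: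
  -- comparison with midpoints shows that each form vanishing at `z` vanishes on all of `F`.
  obtain ⟨z, hz, hmin⟩ := exists_minimalFor_of_wellFoundedLT (fun z => z ∈ F)
    (fun z => hH.toFinset.filter fun h => f h z = 0) hF.1
  simp only at hz hmin
  have hFl : ∀ x ∈ F, x ∈ closedFace f H s ∧ ∀ y ∈ closedFace f H s, l y ≤ l x := fun x hx => by
    rw [hl] at hx; exact hx
  obtain ⟨hzc, hzl⟩ := hFl z hz
  refine ⟨z, Set.Subset.antisymm (fun x hx => ?_) fun x hx => ?_⟩
  · obtain ⟨hxc, hxl⟩ := hFl x hx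
    have hm : AffineMap.lineMap x z (1 / 2 : ℝ) ∈ F := by
      rw [hl]
      have e : (AffineMap.lineMap x z (1 / 2 : ℝ) : Plane) =
          (1 / 2 : ℝ) • x + (1 / 2 : ℝ) • z := by
        rw [AffineMap.lineMap_apply_module]; norm_num
      rw [e]
      refine ⟨convex_closedFace s hxc hzc (by norm_num) (by norm_num) (by norm_num),
        fun y hy => ?_⟩
      rw [map_add, map_smul, map_smul, smul_eq_mul, smul_eq_mul]
      linarith [hxl y hy, hzl y hy]
    have hzero : ∀ h ∈ H, f h (AffineMap.lineMap x z (1 / 2 : ℝ)) = 0 → f h x = 0 ∧ f h z = 0 := by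
      intro h hh h0
      rw [affine_lineMap] at h0
      have a := hxc h hh
      have b := hzc h hh
      rcases le_total 0 (f h s) with hs | hs
      · have := a.1 hs
        have := b.1 hs
        constructor <;> linarith
      · have := a.2 hs
        have := b.2 hs
        constructor <;> linarith
    have hsub := hmin hm (fun h hh => by
      rw [Finset.mem_filter, Set.Finite.mem_toFinset] at hh ⊢
      exact ⟨hh.1, (hzero h hh.1 hh.2).2⟩)
    have hxz : ∀ h ∈ H, f h z = 0 → f h x = 0 := fun h hh h0 => by
      have := hsub (Finset.mem_filter.2 ⟨hH.mem_toFinset.2 hh, h0⟩)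
      exact (hzero h hh (Finset.mem_filter.1 this).2).1
    intro h hh
    have a := hxc h hh
    have b := hzc h hh
    constructor
    · intro h0
      by_cases hz0 : f h z = 0
      · exact (hxz h hh hz0).ge
      · refine a.1 (le_of_not_gt fun hs => hz0 (le_antisymm (b.2 hs.le) h0))
    · intro h0
      by_cases hz0 : f h z = 0
      · exact (hxz h hh hz0).le
      · refine a.2 (le_of_not_gt fun hs => hz0 (le_antisymm h0 (b.1 hs.le)))
  · rw [hl]
    refine ⟨closedFace_trans hzc hx, fun y hy => (hzl y hy).trans ?_⟩
    obtain ⟨ε, hε, hmem⟩ := exists_lineMap_mem_openFace hH hx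
    have := hzl _ (closedFace_trans hzc (openFace_subset_closedFace _ hmem))
    rw [AffineMap.lineMap_apply_module, map_add, map_smul, map_smul, smul_eq_mul,
      smul_eq_mul] at this
    nlinarith

theorem isFaceOf_inter (hH : H.Finite) (s s' : Plane)
    (hne : (closedFace f H s ∩ closedFace f H s').Nonempty) :
    IsFaceOf (closedFace f H s ∩ closedFace f H s') (closedFace f H s) := by
  classical
  refine ⟨hne, fun _ => ?_⟩
  -- The exposing functional is, up to a constant, minus the sum of the forms whose signs at `s` and
  -- `s'` differ, each oriented by its sign at `s`. Each summand `G h * f h x` is nonnegative on the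
  -- face of `s`, and all vanish exactly on the intersection.
  set G : κ → ℝ := fun h => if SignType.sign (f h s) = SignType.sign (f h s') then 0 else
    (SignType.sign (f h s) : ℝ) with hG
  set l : StrongDual ℝ Plane := ∑ h ∈ hH.toFinset,
    (-G h) • LinearMap.toContinuousLinearMap (f h).linear with hl
  set C : ℝ := ∑ h ∈ hH.toFinset, G h * f h 0 with hC
  have hlx : ∀ x, l x = C - ∑ h ∈ hH.toFinset, G h * f h x := fun x => by
    rw [hl, hC, ← Finset.sum_sub_distrib, sum_apply]
    refine Finset.sum_congr rfl fun h _ => ?_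
    rw [affine_eq (f h) x]
    simp only [smul_apply, smul_eq_mul]
    ring
  have hpos : ∀ x ∈ closedFace f H s, ∀ h ∈ hH.toFinset, 0 ≤ G h * f h x := by
    intro x hx h hh
    have := hx h (hH.mem_toFinset.1 hh)
    simp only [hG]
    split_ifs with hs
    · simp
    rcases lt_trichotomy (f h s) 0 with h0 | h0 | h0
    · rw [sign_neg h0]; simpa using this.2 h0.le
    · rw [h0]; simp
    · rw [sign_pos h0]; simpa using this.1 h0.le
  have hzero : ∀ x ∈ closedFace f H s, x ∈ closedFace f H s' ↔
      ∀ h ∈ hH.toFinset, G h * f h x = 0 := by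
    intro x hx
    constructor
    · intro hx' h hh
      have a := hx h (hH.mem_toFinset.1 hh)
      have b := hx' h (hH.mem_toFinset.1 hh)
      simp only [hG]
      split_ifs with hs
      · simp
      have : f h s = 0 ∨ f h x = 0 := by
        rcases lt_trichotomy (f h s) 0 with h0 | h0 | h0
        · refine Or.inr (le_antisymm (a.2 h0.le) (b.1 (le_of_not_gt fun h1 => hs ?_)))
          rw [sign_neg h0, sign_neg h1]
        · exact Or.inl h0
        · refine Or.inr (le_antisymm (b.2 (le_of_not_gt fun h1 => hs ?_)) (a.1 h0.le))
          rw [sign_pos h0, sign_pos h1]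
      rcases this with h | h <;> simp [h]
    · intro hx' h hh
      have a := hx h hh
      have c := hx' h (hH.mem_toFinset.2 hh)
      simp only [hG] at c
      split_ifs at c with hs
      · exact ⟨fun h0 => a.1 (sign_nonneg_iff.1 (hs ▸ sign_nonneg_iff.2 h0)),
          fun h0 => a.2 (sign_nonpos_iff.1 (hs ▸ sign_nonpos_iff.2 h0))⟩
      · have : f h x = 0 := by
          rcases lt_trichotomy (f h s) 0 with h0 | h0 | h0
          · rw [sign_neg h0] at c; simpa using c
          · exact le_antisymm (a.2 h0.le) (a.1 h0.ge)
          · rw [sign_pos h0] at c; simpa using c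
        simp [this]
  refine ⟨l, ?_⟩
  ext x
  constructor
  · rintro ⟨hx, hx'⟩
    refine ⟨hx, fun y hy => ?_⟩
    rw [hlx, hlx, Finset.sum_eq_zero ((hzero x hx).1 hx')]
    linarith [Finset.sum_nonneg (hpos y hy)]
  · rintro ⟨hx, hx'⟩
    refine ⟨hx, (hzero x hx).2 ?_⟩
    obtain ⟨y, hy, hy'⟩ := hne
    have := hx' y hy
    rw [hlx, hlx, Finset.sum_eq_zero ((hzero y hy).1 hy')] at this
    have h0 := Finset.sum_nonneg (hpos x hx)
    exact (Finset.sum_eq_zero_iff_of_nonneg (hpos x hx)).1 (by linarith)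

/-! ### Counting sign vectors -/

open Classical in
/-- The sign vectors on `Q` of the points of `X`. -/
def signVectors (f : κ → Plane →ᵃ[ℝ] ℝ) (X : Set Plane) (Q : Finset κ) : Set (κ → SignType) :=
  (fun x h => if h ∈ Q then SignType.sign (f h x) else 0) '' X

/-- Deletion and restriction. An old vector seen on both strict sides of `h` is also seen on `h`, by
crossing the segment between two witnesses, so `|S 1| + |S (-1)|` exceeds the number of old vectors
by at most `|S 0|`. -/
theorem encard_signVectors_insert [DecidableEq κ] {X : Set Plane} (hX : Convex ℝ X)
    {Q : Finset κ} {h : κ} (hh : h ∉ Q) :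
    (signVectors f X (insert h Q)).encard ≤
      (signVectors f X Q).encard + 2 * (signVectors f (X ∩ {x | f h x = 0}) Q).encard := by
  set S : SignType → Set (κ → SignType) := fun σ =>
    signVectors f (X ∩ {x | SignType.sign (f h x) = σ}) Q with hS
  have hcov : signVectors f X (insert h Q) ⊆ (fun v => Function.update v h 0) '' S 0 ∪
      ((fun v => Function.update v h 1) '' S 1 ∪ (fun v => Function.update v h (-1)) '' S (-1)) := by
    rintro _ ⟨x, hx, rfl⟩
    have hu : ∀ σ, SignType.sign (f h x) = σ →
        (fun h' => if h' ∈ insert h Q then SignType.sign (f h' x) else 0) ∈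
          (fun v => Function.update v h σ) '' S σ := by
      intro σ hσ
      refine ⟨_, ⟨x, ⟨hx, hσ⟩, rfl⟩, ?_⟩
      funext h'
      by_cases h1 : h' = h
      · subst h1; simp [hσ]
      · simp [h1]
    rcases hs : SignType.sign (f h x) with _ | _ | _
    · exact Or.inl (by convert hu 0 hs)
    · exact Or.inr (Or.inr (by convert hu (-1) (by rw [hs]; rfl)))
    · exact Or.inr (Or.inl (by convert hu 1 hs))
  have h0 : S 0 = signVectors f (X ∩ {x | f h x = 0}) Q := by
    simp only [hS, sign_eq_zero_iff]
  have hun : S 1 ∪ S (-1) ⊆ signVectors f X Q :=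
    Set.union_subset (Set.image_mono Set.inter_subset_left) (Set.image_mono Set.inter_subset_left)
  have hint : S 1 ∩ S (-1) ⊆ S 0 := by
    rintro v ⟨⟨x, ⟨hx, hx1⟩, hxv⟩, ⟨y, ⟨hy, hy1⟩, hyv⟩⟩
    rw [Set.mem_ofPred_eq, sign_eq_one_iff] at hx1
    rw [Set.mem_ofPred_eq, sign_eq_neg_one_iff] at hy1
    set c := f h x / (f h x - f h y) with hc
    have hd : 0 < f h x - f h y := by linarith
    have hc0 : 0 < c := div_pos hx1 hd
    have hc1 : c < 1 := (div_lt_one hd).2 (by linarith)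
    refine ⟨AffineMap.lineMap x y c, ⟨?_, ?_⟩, ?_⟩
    · rw [AffineMap.lineMap_apply_module]
      exact hX hx hy (by linarith) hc0.le (by ring)
    · rw [Set.mem_ofPred_eq, sign_eq_zero_iff, affine_lineMap, hc]
      field_simp
      ring
    · rw [← hxv]
      funext h'
      by_cases h1 : h' ∈ Q
      · have e := congrFun (hxv.trans hyv.symm) h'
        simp only [h1, if_true] at e ⊢
        rw [affine_lineMap]
        rcases lt_trichotomy (f h' x) 0 with h2 | h2 | h2
        · have h3 := sign_eq_neg_one_iff.1 (e ▸ sign_neg h2)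
          rw [sign_neg h2, sign_neg]
          nlinarith [mul_pos (sub_pos.2 hc1) (neg_pos.2 h2), mul_pos hc0 (neg_pos.2 h3)]
        · have h3 : f h' y = 0 := by rw [h2, sign_zero] at e; exact sign_eq_zero_iff.1 e.symm
          rw [h2, h3]; simp
        · have h3 := sign_eq_one_iff.1 (e ▸ sign_pos h2)
          rw [sign_pos h2, sign_pos]
          nlinarith [mul_pos (sub_pos.2 hc1) h2, mul_pos hc0 h3]
      · simp [h1]
  calc (signVectors f X (insert h Q)).encard
      ≤ (S 0).encard + ((S 1).encard + (S (-1)).encard) := by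
        refine (Set.encard_le_encard hcov).trans ((Set.encard_union_le _ _).trans ?_)
        refine add_le_add (Set.encard_image_le _ _) ((Set.encard_union_le _ _).trans ?_)
        exact add_le_add (Set.encard_image_le _ _) (Set.encard_image_le _ _)
    _ = (S 0).encard + ((S 1 ∪ S (-1)).encard + (S 1 ∩ S (-1)).encard) := by
        rw [Set.encard_union_add_encard_inter]
    _ ≤ (S 0).encard + ((signVectors f X Q).encard + (S 0).encard) := by
        gcongr
    _ = _ := by rw [h0]; ring

theorem encard_signVectors_insert_of_subset [DecidableEq κ] {X : Set Plane} {Q : Finset κ} {h : κ}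
    (hX : ∀ x ∈ X, f h x = 0) :
    (signVectors f X (insert h Q)).encard ≤ (signVectors f X Q).encard := by
  refine (Set.encard_le_encard ?_).trans
    (Set.encard_image_le (fun v => Function.update v h 0) (signVectors f X Q))
  rintro _ ⟨x, hx, rfl⟩
  refine ⟨_, ⟨x, hx, rfl⟩, ?_⟩
  funext h'
  by_cases h1 : h' = h
  · subst h1; simp [hX x hx]
  · simp [h1]

theorem encard_signVectors_le_linear {X : Set Plane} (hX : Convex ℝ X) (Q : Finset κ)
    (hQ : ∀ h ∈ Q, (X ∩ {x | f h x = 0}).Subsingleton ∨ ∀ x ∈ X, f h x = 0) :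
    (signVectors f X Q).encard ≤ 2 * Q.card + 1 := by
  classical
  induction Q using Finset.induction_on with
  | empty =>
    have : (signVectors f X ∅).Subsingleton := by
      rintro _ ⟨x, _, rfl⟩ _ ⟨y, _, rfl⟩; simp
    simpa using Set.encard_le_one_iff_subsingleton.2 this
  | insert h Q hh ih =>
    have ih := ih fun h' h1 => hQ h' (Finset.mem_insert_of_mem h1)
    rw [Finset.card_insert_of_notMem hh]
    rcases hQ h (Finset.mem_insert_self _ _) with h1 | h1
    · have h2 : (signVectors f (X ∩ {x | f h x = 0}) Q).encard ≤ 1 :=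
        Set.encard_le_one_iff_subsingleton.2 (h1.image _)
      calc _ ≤ _ := encard_signVectors_insert hX hh
        _ ≤ (2 * Q.card + 1 : ℕ∞) + 2 * 1 := by gcongr
        _ = _ := by push_cast; ring
    · refine (encard_signVectors_insert_of_subset h1).trans (ih.trans ?_)
      push_cast
      gcongr
      exact le_self_add

theorem eq_zero_of_two_zeros {g g' : Plane →ᵃ[ℝ] ℝ} (hg : g.linear ≠ 0) {x y z : Plane}
    (hxy : x ≠ y) (hx : g x = 0) (hy : g y = 0) (hz : g z = 0) (hx' : g' x = 0) (hy' : g' y = 0) :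
    g' z = 0 := by
  have hr : Module.finrank ℝ g.linear.range = 1 := by
    rw [LinearMap.range_eq_top.2 (LinearMap.surjective hg), finrank_top, Module.finrank_self]
  have hk : Module.finrank ℝ g.linear.ker = 1 := by
    have := g.linear.finrank_range_add_finrank_ker
    rw [hr, finrank_euclideanSpace_fin] at this
    omega
  have e : ∀ (g : Plane →ᵃ[ℝ] ℝ) (u v : Plane), g.linear (u - v) = g u - g v := fun g u v => by
    rw [← vsub_eq_sub, AffineMap.linearMap_vsub, vsub_eq_sub]
  have h1 : y - x ∈ g.linear.ker := by rw [LinearMap.mem_ker, e, hx, hy, sub_zero]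
  have h2 : z - x ∈ g.linear.ker := by rw [LinearMap.mem_ker, e, hx, hz, sub_zero]
  obtain ⟨c, hc⟩ := (finrank_eq_one_iff_of_nonzero' (⟨y - x, h1⟩ : g.linear.ker)
    (fun h => hxy (sub_eq_zero.1 (congrArg Subtype.val h)).symm)).1 hk ⟨z - x, h2⟩
  have hc' : c • (y - x) = z - x := congrArg Subtype.val hc
  have := e g' z x
  rw [← hc', map_smul, e, hx', hy'] at this
  simp at this
  exact this.symm

/-- On the zero line of a new form, every old form vanishes at one point at most or identically, so
the restriction has at most `2 * |Q| + 1` vectors. Twice this is the increment of the quadratic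
bound. -/
theorem encard_signVectors_univ_le (Q : Finset κ) (hQ : ∀ h ∈ Q, (f h).linear ≠ 0) :
    (signVectors f Set.univ Q).encard ≤ 2 * Q.card ^ 2 + 1 := by
  classical
  induction Q using Finset.induction_on with
  | empty =>
    have : (signVectors f Set.univ ∅).Subsingleton := by
      rintro _ ⟨x, _, rfl⟩ _ ⟨y, _, rfl⟩; simp
    simpa using Set.encard_le_one_iff_subsingleton.2 this
  | insert h Q hh ih =>
    have ih := ih fun h' h1 => hQ h' (Finset.mem_insert_of_mem h1)
    rw [Finset.card_insert_of_notMem hh]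
    have hconv : Convex ℝ {x | f h x = 0} := by
      have : {x | f h x = 0} = f h ⁻¹' {0} := rfl
      rw [this]
      exact (convex_singleton 0).affine_preimage (f h)
    have h2 := encard_signVectors_le_linear (f := f) hconv Q fun h' _ => by
      by_cases hs : ({x | f h x = 0} ∩ {x | f h' x = 0}).Subsingleton
      · exact Or.inl hs
      · rw [Set.not_subsingleton_iff] at hs
        obtain ⟨x, hx, y, hy, hxy⟩ := hs
        exact Or.inr fun z hz => eq_zero_of_two_zeros (hQ h (Finset.mem_insert_self _ _)) hxy
          hx.1 hy.1 hz hx.2 hy.2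
    calc _ ≤ _ := encard_signVectors_insert convex_univ hh
      _ ≤ (2 * Q.card ^ 2 + 1 : ℕ∞) + 2 * (2 * Q.card + 1) := by
        rw [Set.univ_inter]; gcongr
      _ = _ := by push_cast; ring

theorem encard_range_closedFace_le (hH : H.Finite) (hl : ∀ h ∈ H, (f h).linear ≠ 0) :
    (Set.range (closedFace f H)).encard ≤ 2 * H.ncard ^ 2 + 1 := by
  classical
  have h1 := encard_signVectors_univ_le (f := f) hH.toFinset
    fun h hh => hl h (hH.mem_toFinset.1 hh)
  rw [← Set.ncard_eq_toFinset_card H hH] at h1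
  refine le_trans (le_trans (Set.encard_le_encard ?_) (Set.encard_image_le
    (fun v : κ → SignType => {t : Plane | ∀ h ∈ H, (0 ≤ v h → 0 ≤ f h t) ∧
      (v h ≤ 0 → f h t ≤ 0)}) _)) h1
  rintro _ ⟨s, rfl⟩
  refine ⟨_, ⟨s, Set.mem_univ _, rfl⟩, ?_⟩
  ext t
  simp only [closedFace, Set.mem_ofPred_eq, Set.Finite.mem_toFinset]
  refine forall₂_congr fun h hh => ?_
  rw [if_pos hh, sign_nonneg_iff, sign_nonpos_iff]

/-- The closed faces form a polyhedral complex. -/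
theorem isPolyhedralComplex_range_closedFace (hH : H.Finite) (hl : ∀ h ∈ H, (f h).linear ≠ 0) :
    IsPolyhedralComplex (Set.range (closedFace f H)) where
  finite := Set.encard_lt_top_iff.1 ((encard_range_closedFace_le hH hl).trans_lt
    (by exact_mod_cast ENat.natCast_lt_top (2 * H.ncard ^ 2 + 1)))
  polyhedron := by
    rintro _ ⟨s, rfl⟩
    exact isPolyhedron_closedFace hH s
  nonempty := by
    rintro _ ⟨s, rfl⟩
    exact ⟨s, mem_closedFace_self s⟩
  face_mem := by
    rintro _ ⟨s, rfl⟩ F hF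
    obtain ⟨z, rfl⟩ := exists_eq_closedFace_of_isFaceOf hH hF
    exact ⟨z, rfl⟩
  inter_face := by
    rintro _ ⟨s, rfl⟩ _ ⟨s', rfl⟩ hne
    refine ⟨isFaceOf_inter hH s s' hne, ?_⟩
    rw [Set.inter_comm] at hne ⊢
    exact isFaceOf_inter hH s' s hne

/-! ### Generic points -/

theorem dense_ne_zero {g : Plane →ᵃ[ℝ] ℝ} (hg : g.linear ≠ 0) : Dense {x | g x ≠ 0} := by
  have : {x | g x ≠ 0} = {x | g x = 0}ᶜ := rfl
  rw [this, ← interior_eq_empty_iff_dense_compl, Set.eq_empty_iff_forall_notMem]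
  intro x hx
  obtain ⟨w, hw⟩ : ∃ w, g.linear w ≠ 0 := by
    by_contra! hcon
    exact hg (LinearMap.ext hcon)
  have hc : Continuous fun ε : ℝ => x + ε • w := by fun_prop
  have := hc.tendsto 0
  rw [zero_smul, add_zero] at this
  have hev := this.eventually (mem_interior_iff_mem_nhds.1 hx)
  obtain ⟨ε, h1, h2⟩ := ((hev.filter_mono (nhdsWithin_le_nhds (s := Set.Ioi 0))).and
    self_mem_nhdsWithin).exists
  have h1 : g (x + ε • w) = 0 := h1
  have h0 : x ∈ {x | g x = 0} := interior_subset hx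
  replace h0 : g x = 0 := h0
  have h2 : 0 < ε := h2
  rw [add_comm, ← vadd_eq_add, AffineMap.map_vadd, h0, map_smul] at h1
  simp at h1
  exact h1.elim h2.ne' hw

theorem dense_generic (hH : H.Finite) (hl : ∀ h ∈ H, (f h).linear ≠ 0) :
    Dense {x | ∀ h ∈ H, f h x ≠ 0} := by
  have : {x | ∀ h ∈ H, f h x ≠ 0} = ⋂ h ∈ H, {x | f h x ≠ 0} := by ext; simp
  rw [this]
  exact dense_biInter_of_isOpen
    (fun h _ => isOpen_ne_fun (continuous_affine (f h)) continuous_const)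
    hH.countable fun h hh => dense_ne_zero (hl h hh)

theorem isOpen_openFace (hH : H.Finite) {s : Plane} (hs : ∀ h ∈ H, f h s ≠ 0) :
    IsOpen (openFace f H s) := by
  rw [isOpen_iff_mem_nhds]
  intro t ht
  refine (Filter.eventually_all_finite hH).2 fun h hh => ?_
  have h0 : f h t ≠ 0 := fun h0 => by
    have := ht h hh
    rw [h0, sign_zero, sign_eq_zero_iff] at this
    exact hs h hh this
  filter_upwards [eventually_sign_eq h0] with y hy
  exact (ht h hh).trans hy

/-- Every open face lies in the closure of a face of full dimension. -/
theorem exists_generic_closedFace {H' : Set κ} (hH : H'.Finite)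
    (hl : ∀ h ∈ H', (f h).linear ≠ 0) (hHH : H ⊆ H') (s : Plane) :
    ∃ s', (∀ h ∈ H', f h s' ≠ 0) ∧ openFace f H s ⊆ closedFace f H s' := by
  have hev : ∀ᶠ x in nhds s, ∀ h ∈ H', f h s ≠ 0 →
      SignType.sign (f h s) = SignType.sign (f h x) := by
    refine (Filter.eventually_all_finite hH).2 fun h hh => ?_
    by_cases h0 : f h s = 0
    · simp [h0]
    · filter_upwards [eventually_sign_eq h0] with x hx _ using hx
  obtain ⟨s', h1, h2⟩ := (dense_generic hH hl).inter_nhds_nonempty hev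
  refine ⟨s', h1, fun t ht h hh => ?_⟩
  have a := ht h hh
  by_cases h0 : f h s = 0
  · rw [h0, sign_zero] at a
    have : f h t = 0 := sign_eq_zero_iff.1 a.symm
    simp [this]
  · have b := h2 h (hHH hh) h0
    rw [b] at a
    exact ⟨fun h0 => sign_nonneg_iff.1 (a ▸ sign_nonneg_iff.2 h0),
      fun h0 => sign_nonpos_iff.1 (a ▸ sign_nonpos_iff.2 h0)⟩

end SignVectors
end

noncomputable section

/-! ### Lines and their arrangements -/

/-- A line: the zero set of a nonconstant affine function. -/
def IsLine (h : Set Plane) : Prop :=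
  ∃ g : Plane →ᵃ[ℝ] ℝ, g.linear ≠ 0 ∧ h = {t | g t = 0}

open Classical in
/-- An affine function with zero set `h`, if `h` is a line. -/
def lineForm (h : Set Plane) : Plane →ᵃ[ℝ] ℝ :=
  if hh : IsLine h then hh.choose else 0

theorem IsLine.linear_ne_zero {h : Set Plane} (hh : IsLine h) : (lineForm h).linear ≠ 0 := by
  rw [lineForm, dif_pos hh]; exact hh.choose_spec.1

theorem IsLine.eq_zeros {h : Set Plane} (hh : IsLine h) : h = {t | lineForm h t = 0} := by
  rw [lineForm, dif_pos hh]; exact hh.choose_spec.2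

theorem IsLine.mem_iff {h : Set Plane} (hh : IsLine h) (t : Plane) :
    t ∈ h ↔ lineForm h t = 0 := by
  conv_lhs => rw [hh.eq_zeros]
  rfl

theorem segment_subset_or_disjoint_iff (g : Plane →ᵃ[ℝ] ℝ) (s t : Plane) :
    (segment ℝ s t ⊆ {x | g x = 0} ∨ Disjoint (segment ℝ s t) {x | g x = 0}) ↔
      SignType.sign (g s) = SignType.sign (g t) := by
  rw [segment_eq_image_lineMap]
  constructor
  · rintro (h | h)
    · have h0 : g s = 0 := h ⟨0, by simp, by simp⟩
      have h1 : g t = 0 := h ⟨1, by simp, by simp⟩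
      rw [h0, h1]
    · have hne : ∀ c ∈ Set.Icc (0 : ℝ) 1, (1 - c) * g s + c * g t ≠ 0 := fun c hc h0 =>
        Set.disjoint_left.1 h ⟨c, hc, rfl⟩ (by
          change g _ = 0
          rw [affine_lineMap, h0])
      by_contra hcon
      have hs0 : g s ≠ 0 := by simpa using hne 0 (by simp)
      have ht0 : g t ≠ 0 := by simpa using hne 1 (by simp)
      have hprod : g s * g t < 0 := by
        rcases lt_or_gt_of_ne hs0 with a | a <;> rcases lt_or_gt_of_ne ht0 with b | b
        · exact absurd (by rw [sign_neg a, sign_neg b]) hcon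
        · exact mul_neg_of_neg_of_pos a b
        · exact mul_neg_of_pos_of_neg a b
        · exact absurd (by rw [sign_pos a, sign_pos b]) hcon
      have hd : g s - g t ≠ 0 := fun h => by
        rw [sub_eq_zero.1 h] at hprod
        exact absurd hprod (not_lt.2 (mul_self_nonneg _))
      refine hne (g s / (g s - g t)) ?_ (by field_simp; ring)
      rcases lt_or_gt_of_ne hd with a | a
      · have : g s < 0 ∧ 0 < g t := by
          rcases mul_neg_iff.1 hprod with b | b
          · linarith
          · exact b
        exact ⟨div_nonneg_of_nonpos this.1.le a.le, (div_le_one_of_neg a).2 (by linarith)⟩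
      · have : 0 < g s ∧ g t < 0 := by
          rcases mul_neg_iff.1 hprod with b | b
          · exact b
          · linarith
        exact ⟨div_nonneg this.1.le a.le, (div_le_one a).2 (by linarith)⟩
  · intro h
    rcases lt_trichotomy (g s) 0 with a | a | a
    · have b := sign_eq_neg_one_iff.1 (h ▸ sign_neg a)
      refine Or.inr (Set.disjoint_left.2 ?_)
      rintro _ ⟨c, hc, rfl⟩ h0
      have h0 : g _ = 0 := h0
      rw [affine_lineMap] at h0
      have := mul_nonneg hc.1 (neg_nonneg.2 b.le)
      have := mul_nonneg (sub_nonneg.2 hc.2) (neg_nonneg.2 a.le)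
      rcases hc.1.eq_or_lt with hc | hc
      · rw [← hc] at h0; simp at h0; linarith
      · nlinarith [mul_pos hc (neg_pos.2 b)]
    · have b : g t = 0 := by rw [a, sign_zero] at h; exact sign_eq_zero_iff.1 h.symm
      refine Or.inl ?_
      rintro _ ⟨c, hc, rfl⟩
      change g _ = 0
      rw [affine_lineMap, a, b]; simp
    · have b := sign_eq_one_iff.1 (h ▸ sign_pos a)
      refine Or.inr (Set.disjoint_left.2 ?_)
      rintro _ ⟨c, hc, rfl⟩ h0
      have h0 : g _ = 0 := h0
      rw [affine_lineMap] at h0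
      have := mul_nonneg hc.1 b.le
      have := mul_nonneg (sub_nonneg.2 hc.2) a.le
      rcases hc.1.eq_or_lt with hc | hc
      · rw [← hc] at h0; simp at h0; linarith
      · nlinarith [mul_pos hc b]

theorem setOf_sameFace {H : Set (Set Plane)} (hl : ∀ h ∈ H, IsLine h) (s : Plane) :
    {t | SameFace H s t} = openFace lineForm H s := by
  ext t
  refine forall₂_congr fun h hh => ?_
  rw [← segment_subset_or_disjoint_iff, ← (hl h hh).eq_zeros]

theorem arrangement_eq {H : Set (Set Plane)} (hl : ∀ h ∈ H, IsLine h) :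
    arrangement H = Set.range (closedFace lineForm H) := by
  ext c
  refine exists_congr fun s => ?_
  rw [setOf_sameFace hl, closure_openFace, eq_comm]

/-- `SameFace` refers only to the line itself, so signs may be read off any form with that zero set,
for instance `bisForm` in place of the arbitrarily chosen `lineForm`. -/
theorem sign_eq_of_mem_openFace {H : Set (Set Plane)} (hl : ∀ h ∈ H, IsLine h) {s t : Plane}
    (ht : t ∈ openFace lineForm H s) {g : Plane →ᵃ[ℝ] ℝ} (hg : {x | g x = 0} ∈ H) :
    SignType.sign (g s) = SignType.sign (g t) := by
  rw [← setOf_sameFace hl] at ht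
  exact (segment_subset_or_disjoint_iff g s t).1 (ht _ hg)

/-! ### Bisectors -/

/-- The difference of the squared distances to `p` and `q`. -/
def bisForm (p q : Plane) : Plane →ᵃ[ℝ] ℝ :=
  (innerSL ℝ ((2 : ℝ) • (q - p))).toLinearMap.toAffineMap +
    AffineMap.const ℝ Plane (‖p‖ ^ 2 - ‖q‖ ^ 2)

theorem bisForm_apply (p q t : Plane) : bisForm p q t = ‖t - p‖ ^ 2 - ‖t - q‖ ^ 2 := by
  have : bisForm p q t = inner ℝ ((2 : ℝ) • (q - p)) t + (‖p‖ ^ 2 - ‖q‖ ^ 2) := rfl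
  rw [this, norm_sub_sq_real, norm_sub_sq_real, inner_smul_left, inner_sub_left,
    real_inner_comm q, real_inner_comm p]
  simp
  ring

theorem bisForm_linear_ne_zero {p q : Plane} (h : p ≠ q) : (bisForm p q).linear ≠ 0 := by
  intro h0
  have : (bisForm p q).linear (q - p) = inner ℝ ((2 : ℝ) • (q - p)) (q - p) := by
    simp [bisForm, inner_smul_left]
    rw [← inner_sub_left, real_inner_self_eq_norm_sq]
  rw [h0, inner_smul_left, real_inner_self_eq_norm_sq] at this
  simp [sub_eq_zero] at this
  exact h this.symm

theorem norm_edge_eq (a b t : Plane) : ‖b + t - a‖ = ‖t - (a - b)‖ := by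
  congr 1; abel

theorem bisector_eq (a b a' b' : Plane) :
    bisector a b a' b' = {t | bisForm (a - b) (a' - b') t = 0} := by
  ext t
  change ‖b + t - a‖ = ‖b' + t - a'‖ ↔ bisForm (a - b) (a' - b') t = 0
  rw [bisForm_apply, norm_edge_eq, norm_edge_eq, sub_eq_zero,
    sq_eq_sq₀ (norm_nonneg _) (norm_nonneg _)]

theorem site_ne {a b a' b' : Plane} (h : b - a ≠ b' - a') : a - b ≠ a' - b' := fun h0 =>
  h (by rw [← neg_sub a b, h0, neg_sub])

theorem isLine_of_mem_bisectors {A B : Finset Plane} : ∀ h ∈ bisectors A B, IsLine h := by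
  rintro _ ⟨a, _, b, _, a', _, b', _, hne, rfl⟩
  exact ⟨_, bisForm_linear_ne_zero (site_ne hne), bisector_eq a b a' b'⟩

theorem usedBisectors_subset (A B : Finset Plane) : usedBisectors A B ⊆ bisectors A B := by
  rintro _ ⟨a, ha, b, hb, a', ha', b', hb', hne, rfl, _⟩
  exact ⟨a, ha, b, hb, a', ha', b', hb', hne, rfl⟩

theorem finite_bisectors (A B : Finset Plane) : (bisectors A B).Finite := by
  refine ((A ×ˢ B ×ˢ A ×ˢ B).finite_toSet.image
    fun x => bisector x.1 x.2.1 x.2.2.1 x.2.2.2).subset ?_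
  rintro _ ⟨a, ha, b, hb, a', ha', b', hb', -, rfl⟩
  exact ⟨(a, b, a', b'), by simp [ha, hb, ha', hb'], rfl⟩

variable {A B : Finset Plane}

theorem isLine_of_mem_usedBisectors : ∀ h ∈ usedBisectors A B, IsLine h := fun h hh =>
  isLine_of_mem_bisectors h (usedBisectors_subset A B hh)

theorem linear_lineForm_ne_zero : ∀ h ∈ bisectors A B, (lineForm h).linear ≠ 0 := fun h hh =>
  (isLine_of_mem_bisectors h hh).linear_ne_zero

theorem norm_edge_lt_iff (a b a' b' t : Plane) :
    ‖b + t - a‖ < ‖b' + t - a'‖ ↔ bisForm (a - b) (a' - b') t < 0 := by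
  rw [bisForm_apply, norm_edge_eq, norm_edge_eq, sub_neg,
    sq_lt_sq₀ (norm_nonneg _) (norm_nonneg _)]

theorem norm_edge_le_iff (a b a' b' t : Plane) :
    ‖b + t - a‖ ≤ ‖b' + t - a'‖ ↔ bisForm (a - b) (a' - b') t ≤ 0 := by
  rw [bisForm_apply, norm_edge_eq, norm_edge_eq, sub_nonpos,
    sq_le_sq₀ (norm_nonneg _) (norm_nonneg _)]

/-- The order of the edge lengths is constant on the open faces of `lex(A, B)`. -/
theorem sign_bisForm_eq {s t : Plane} (ht : t ∈ openFace lineForm (bisectors A B) s)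
    {a b a' b' : Plane} (ha : a ∈ A) (hb : b ∈ B) (ha' : a' ∈ A) (hb' : b' ∈ B) :
    SignType.sign (bisForm (a - b) (a' - b') s) = SignType.sign (bisForm (a - b) (a' - b') t) := by
  by_cases hne : b - a = b' - a'
  · have : a - b = a' - b' := by rw [← neg_sub b a, hne, neg_sub]
    rw [this, bisForm_apply, bisForm_apply]; simp
  · apply sign_eq_of_mem_openFace isLine_of_mem_bisectors ht
    exact ⟨a, ha, b, hb, a', ha', b', hb', hne, (bisector_eq a b a' b').symm⟩

/-- A strict order of the edge lengths at a point of a cell persists in its interior. -/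
theorem norm_lt_of_mem_interior {c s t : Plane}
    (hs : s ∈ closedFace lineForm (bisectors A B) c)
    (ht : t ∈ interior (closedFace lineForm (bisectors A B) c))
    {a b a' b' : Plane} (ha : a ∈ A) (hb : b ∈ B) (ha' : a' ∈ A) (hb' : b' ∈ B)
    (h : ‖b + s - a‖ < ‖b' + s - a'‖) : ‖b + t - a‖ < ‖b' + t - a'‖ := by
  rw [norm_edge_lt_iff] at h ⊢
  set g := bisForm (a - b) (a' - b') with hg
  have hc : g c < 0 := by
    rw [← closure_openFace] at hs
    obtain ⟨u, hu, hu'⟩ := mem_closure_iff_nhds.1 hs _ (eventually_sign_eq h.ne)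
    have h1 := sign_bisForm_eq hu' ha hb ha' hb'
    have hu : SignType.sign (g s) = SignType.sign (g u) := hu
    rw [← hg, ← hu, sign_neg h] at h1
    exact sign_eq_neg_one_iff.1 h1
  have hle : ∀ x ∈ closedFace lineForm (bisectors A B) c, g x ≤ 0 := by
    intro x hx
    rw [← closure_openFace] at hx
    refine closure_minimal (t := {x | g x ≤ 0}) (fun u hu => ?_)
      (isClosed_le (continuous_affine g) continuous_const) hx
    have h1 := sign_bisForm_eq hu ha hb ha' hb'
    rw [← hg, sign_neg hc] at h1
    exact (sign_eq_neg_one_iff.1 h1.symm).le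
  -- If `g t = 0` while `g s < 0`, then `g` is positive just beyond `t` on the ray from `s`, which
  -- is still inside the cell.
  refine lt_of_le_of_ne (hle t (interior_subset ht)) fun h0 => ?_
  have hcont : Continuous fun ε : ℝ => (AffineMap.lineMap s t (1 + ε) : Plane) :=
    (continuous_lineMap_plane s t).comp (continuous_const.add continuous_id)
  have hev := hcont.tendsto 0
  rw [add_zero, AffineMap.lineMap_apply_one] at hev
  obtain ⟨ε, h1, h2⟩ := (((hev.eventually (mem_interior_iff_mem_nhds.1 ht)).filter_mono
    (nhdsWithin_le_nhds (s := Set.Ioi 0))).and self_mem_nhdsWithin).exists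
  have h2 : 0 < ε := h2
  have := hle _ h1
  rw [affine_lineMap, h0] at this
  nlinarith

/-- Candidates of a cell have few strictly shorter edges at all points of the closed cell. -/
theorem card_closer_lt_of_mem_cellCandidates {c s : Plane} {e : Plane × Plane}
    (hs : s ∈ closedFace lineForm (bisectors A B) c)
    (he : e ∈ cellCandidates A B (closedFace lineForm (bisectors A B) c)) :
    {a ∈ A | ‖e.2 + s - a‖ < ‖e.2 + s - e.1‖}.card < B.card := by
  obtain ⟨t, ht, hA, hB, hcard⟩ := he
  refine lt_of_le_of_lt (Finset.card_le_card fun a ha => ?_) hcard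
  rw [Finset.mem_filter] at ha ⊢
  exact ⟨ha.1, norm_lt_of_mem_interior hs ht ha.1 hB hA hB ha.2⟩

/-! ### Counting the used bisectors -/

/-- The sweep needs distinct slopes, but sites may share a first coordinate. A shear that avoids
finitely many values of `μ` separates them. -/
theorem exists_slope_injOn (S : Finset Plane) :
    ∃ μ : ℝ, Set.InjOn (fun p : Plane => -2 * (p 0 + μ * p 1)) S := by
  classical
  obtain ⟨μ, hμ⟩ := Infinite.exists_notMem_finset
    ((S ×ˢ S).image fun x : Plane × Plane => -(x.1 0 - x.2 0) / (x.1 1 - x.2 1))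
  refine ⟨μ, fun p hp q hq h => ?_⟩
  simp only at h
  have h1 : p 1 = q 1 := by
    by_contra hne
    refine hμ (Finset.mem_image.2 ⟨(p, q), Finset.mem_product.2 ⟨hp, hq⟩, ?_⟩)
    rw [div_eq_iff (sub_ne_zero.2 hne)]
    linarith
  have h0 : p 0 = q 0 := by rw [h1] at h; linarith
  ext i
  fin_cases i
  · exact h0
  · exact h1

/-- This is the lifting map in sheared coordinates: the term `‖s‖ ^ 2` common to all sites is
removed, so comparing distances becomes comparing affine functions. -/
theorem affVal_site (μ : ℝ) (p s : Plane) :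
    affVal (fun p : Plane => -2 * (p 0 + μ * p 1)) (fun p => -2 * p 1) (fun p => ‖p‖ ^ 2) p
      (s 0) (s 1 - μ * s 0) = ‖s - p‖ ^ 2 - ‖s‖ ^ 2 := by
  simp only [affVal, EuclideanSpace.norm_sq_eq, Fin.sum_univ_two, Real.norm_eq_abs, sq_abs,
    PiLp.sub_apply]
  ring

/-- The pairs of sites in `S` that are equidistant from some point, with no further ties and with
fewer than `j` sites of `S` closer to the point, determine few lines. -/
theorem exists_finset_bisectors (S : Finset Plane) {j : ℕ} (hj : 0 < j) :
    ∃ Q : Finset (Set Plane), Q.card ≤ 12 * (j * S.card) ∧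
      ∀ p ∈ S, ∀ q ∈ S, p ≠ q → (∃ s : Plane, ‖s - p‖ = ‖s - q‖ ∧
        (∀ r ∈ S, r ≠ p → r ≠ q → ‖s - r‖ ≠ ‖s - p‖) ∧
        {r ∈ S | ‖s - r‖ < ‖s - p‖}.card < j) → {t : Plane | ‖t - p‖ = ‖t - q‖} ∈ Q := by
  classical
  obtain ⟨μ, hμ⟩ := exists_slope_injOn S
  set P := shallowPairs (fun p : Plane => -2 * (p 0 + μ * p 1)) (fun p => -2 * p 1)
    (fun p => ‖p‖ ^ 2) S j with hP
  have hlt : ∀ p q s : Plane, ‖s - p‖ ^ 2 - ‖s‖ ^ 2 < ‖s - q‖ ^ 2 - ‖s‖ ^ 2 ↔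
      ‖s - p‖ < ‖s - q‖ := fun p q s => by
    rw [sub_lt_sub_iff_right, sq_lt_sq₀ (norm_nonneg _) (norm_nonneg _)]
  have heq : ∀ p q s : Plane, ‖s - p‖ ^ 2 - ‖s‖ ^ 2 = ‖s - q‖ ^ 2 - ‖s‖ ^ 2 ↔
      ‖s - p‖ = ‖s - q‖ := fun p q s => by
    rw [sub_left_inj, sq_eq_sq₀ (norm_nonneg _) (norm_nonneg _)]
  have key : ∀ p ∈ S, ∀ q ∈ S, -2 * (q 0 + μ * q 1) < -2 * (p 0 + μ * p 1) →
      (∃ s : Plane, ‖s - p‖ = ‖s - q‖ ∧ (∀ r ∈ S, r ≠ p → r ≠ q → ‖s - r‖ ≠ ‖s - p‖) ∧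
        {r ∈ S | ‖s - r‖ < ‖s - p‖}.card < j) → (p, q) ∈ P := by
    rintro p hp q hq hpq ⟨s, h1, h2, h3⟩
    rw [hP, shallowPairs, Finset.mem_filter, Finset.mem_product]
    refine ⟨⟨hp, hq⟩, hpq, s 0, s 1 - μ * s 0, ?_, fun r hr hr1 hr2 => ?_, ?_⟩
    · rw [affVal_site, affVal_site, heq, h1]
    · rw [affVal_site, affVal_site, Ne, heq]
      exact h2 r hr hr1 hr2
    · refine lt_of_le_of_lt (Finset.card_le_card fun r hr => ?_) h3
      rw [Finset.mem_filter] at hr ⊢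
      rw [affVal_site, affVal_site, hlt] at hr
      exact hr
  refine ⟨P.image fun e => {t : Plane | ‖t - e.1‖ = ‖t - e.2‖},
    Finset.card_image_le.trans (card_shallowPairs_le hμ hj), fun p hp q hq hne hs => ?_⟩
  rcases lt_trichotomy (-2 * (q 0 + μ * q 1)) (-2 * (p 0 + μ * p 1)) with h | h | h
  · exact Finset.mem_image.2 ⟨(p, q), key p hp q hq h hs, rfl⟩
  · exact absurd (hμ hq hp h) hne.symm
  · refine Finset.mem_image.2 ⟨(q, p), key q hq p hp h ?_, by ext t; exact eq_comm⟩
    obtain ⟨s, h1, h2, h3⟩ := hs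
    exact ⟨s, h1.symm, fun r hr hr1 hr2 => h1 ▸ h2 r hr hr2 hr1, h1 ▸ h3⟩

theorem exists_ne_of_finrank_vectorSpan {F : Set Plane}
    (hF : Module.finrank ℝ (vectorSpan ℝ F) = 1) : ∃ x ∈ F, ∃ y ∈ F, x ≠ y := by
  by_contra! hcon
  have hsub : F.Subsingleton := fun x hx y hy => hcon x hx y hy
  rw [vectorSpan_of_subsingleton ℝ hsub] at hF
  simp at hF

theorem ncard_usedBisectors_le (hB : B.Nonempty) :
    (usedBisectors A B).ncard ≤ 48 * (A.card * B.card ^ 3) := by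
  classical
  have hk : 0 < 2 * B.card := by have := hB.card_pos; omega
  set S : Plane × Plane → Finset Plane := fun b =>
    (A.image fun a => a - b.1) ∪ (A.image fun a => a - b.2) with hS
  choose Q hQ hQ' using fun b : Plane × Plane => exists_finset_bisectors (S b) hk
  have hSc : ∀ b, (S b).card ≤ 2 * A.card := fun b => by
    refine (Finset.card_union_le _ _).trans ?_
    have := Finset.card_image_le (s := A) (f := fun a => a - b.1)
    have := Finset.card_image_le (s := A) (f := fun a => a - b.2)
    omega
  have hsub : usedBisectors A B ⊆ ((B ×ˢ B).biUnion Q : Finset (Set Plane)) := by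
    rintro _ ⟨a, ha, b, hb, a', ha', b', hb', hne, rfl, F, C, D, ⟨hFa, hF1, ⟨hC, -⟩, ⟨hD, -⟩, hFCD⟩,
      hFh, hz, hz'⟩
    rw [lexArrangement, arrangement_eq isLine_of_mem_bisectors] at hFa hC hD
    obtain ⟨s, rfl⟩ := hFa
    obtain ⟨c, rfl⟩ := hC
    obtain ⟨d, rfl⟩ := hD
    have hsF := mem_closedFace_self (f := lineForm) (H := bisectors A B) s
    have hsC : s ∈ closedFace lineForm (bisectors A B) c := (hFCD ▸ hsF).1
    have hsD : s ∈ closedFace lineForm (bisectors A B) d := (hFCD ▸ hsF).2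
    have hcard : ∀ e ∈ cellCandidates A B (closedFace lineForm (bisectors A B) c) ∪
        cellCandidates A B (closedFace lineForm (bisectors A B) d),
        {a ∈ A | ‖e.2 + s - a‖ < ‖e.2 + s - e.1‖}.card < B.card := by
      rintro e (he | he)
      · exact card_closer_lt_of_mem_cellCandidates hsC he
      · exact card_closer_lt_of_mem_cellCandidates hsD he
    have h1 := hcard _ hz
    have h2 := hcard _ hz'
    simp only at h1 h2
    have hsh : ‖b + s - a‖ = ‖b' + s - a'‖ := hFh hsF
    rw [Finset.mem_coe, Finset.mem_biUnion]
    refine ⟨(b, b'), Finset.mem_product.2 ⟨hb, hb'⟩, ?_⟩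
    have e : bisector a b a' b' = {t : Plane | ‖t - (a - b)‖ = ‖t - (a' - b')‖} := by
      ext t
      change ‖b + t - a‖ = ‖b' + t - a'‖ ↔ ‖t - (a - b)‖ = ‖t - (a' - b')‖
      rw [norm_edge_eq, norm_edge_eq]
    rw [e]
    refine hQ' (b, b') _ (Finset.mem_union_left _ (Finset.mem_image_of_mem _ ha)) _
      (Finset.mem_union_right _ (Finset.mem_image_of_mem _ ha')) (site_ne hne) ⟨s, ?_, ?_, ?_⟩
    · rw [← norm_edge_eq, ← norm_edge_eq, hsh]
    -- A further tie at `s` lies on a bisector through `s`, hence holds on all of `F`. Then three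
    -- sites would be equidistant from each of two distinct points of `F`, which in the plane forces
    -- `r` to be one of the two given sites.
    · intro r hr hr1 hr2 heq
      obtain ⟨a₀, ha₀, b₀, hb₀, rfl⟩ : ∃ a₀ ∈ A, ∃ b₀ ∈ B, r = a₀ - b₀ := by
        rcases Finset.mem_union.1 hr with hr | hr
        · obtain ⟨a₀, ha₀, rfl⟩ := Finset.mem_image.1 hr
          exact ⟨a₀, ha₀, b, hb, rfl⟩
        · obtain ⟨a₀, ha₀, rfl⟩ := Finset.mem_image.1 hr
          exact ⟨a₀, ha₀, b', hb', rfl⟩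
      have hmem : bisector a b a₀ b₀ ∈ bisectors A B := by
        refine ⟨a, ha, b, hb, a₀, ha₀, b₀, hb₀, fun h => hr1 ?_, rfl⟩
        rw [← neg_sub b₀ a₀, ← h, neg_sub]
      have hl := isLine_of_mem_bisectors _ hmem
      have hF₀ : closedFace lineForm (bisectors A B) s ⊆ bisector a b a₀ b₀ := by
        intro t ht
        have hs0 : lineForm (bisector a b a₀ b₀) s = 0 := (hl.mem_iff s).1 (by
          change ‖b + s - a‖ = ‖b₀ + s - a₀‖
          rw [norm_edge_eq, norm_edge_eq, heq])
        rw [hl.mem_iff]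
        exact le_antisymm ((ht _ hmem).2 hs0.le) ((ht _ hmem).1 hs0.ge)
      obtain ⟨x, hx, y, hy, hxy⟩ := exists_ne_of_finrank_vectorSpan hF1
      have d1 : ∀ t ∈ closedFace lineForm (bisectors A B) s,
          dist (a - b) t = dist (a₀ - b₀) t ∧ dist (a - b) t = dist (a' - b') t := by
        intro t ht
        have u1 : ‖b + t - a‖ = ‖b₀ + t - a₀‖ := hF₀ ht
        have u2 : ‖b + t - a‖ = ‖b' + t - a'‖ := hFh ht
        rw [norm_edge_eq, norm_edge_eq, ← dist_eq_norm, ← dist_eq_norm, dist_comm t,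
          dist_comm t] at u1 u2
        exact ⟨u1, u2⟩
      rcases EuclideanGeometry.eq_of_dist_eq_of_dist_eq_of_finrank_eq_two
        (by rw [finrank_euclideanSpace_fin]) hxy (site_ne hne) rfl (d1 x hx).2.symm
        (d1 x hx).1.symm rfl (d1 y hy).2.symm (d1 y hy).1.symm with h | h
      · exact hr1 h
      · exact hr2 h
    -- Closer sites come from edges at `b` shorter than `ab` or edges at `b'` shorter than `a'b'`.
    -- There are fewer than `k` of each kind, whence the depth `2 * B.card`.
    · have hsub : {r ∈ S (b, b') | ‖s - r‖ < ‖s - (a - b)‖} ⊆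
          ({x ∈ A | ‖b + s - x‖ < ‖b + s - a‖}.image fun x => x - b) ∪
          ({x ∈ A | ‖b' + s - x‖ < ‖b' + s - a'‖}.image fun x => x - b') := by
        intro r hr
        obtain ⟨hr, hlt⟩ := Finset.mem_filter.1 hr
        rcases Finset.mem_union.1 hr with hr | hr
        · obtain ⟨x, hx, rfl⟩ := Finset.mem_image.1 hr
          refine Finset.mem_union_left _ (Finset.mem_image.2 ⟨x, Finset.mem_filter.2 ⟨hx, ?_⟩, rfl⟩)
          rw [norm_edge_eq, norm_edge_eq]
          exact hlt
        · obtain ⟨x, hx, rfl⟩ := Finset.mem_image.1 hr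
          refine Finset.mem_union_right _
            (Finset.mem_image.2 ⟨x, Finset.mem_filter.2 ⟨hx, ?_⟩, rfl⟩)
          rw [← hsh, norm_edge_eq, norm_edge_eq]
          exact hlt
      refine lt_of_le_of_lt ((Finset.card_le_card hsub).trans ((Finset.card_union_le _ _).trans
        (add_le_add Finset.card_image_le Finset.card_image_le))) ?_
      omega
  calc (usedBisectors A B).ncard ≤ ((B ×ˢ B).biUnion Q).card := by
        rw [← Set.ncard_coe_finset]
        exact Set.ncard_le_ncard hsub (Finset.finite_toSet _)
    _ ≤ (B ×ˢ B).card * (12 * (2 * B.card * (2 * A.card))) :=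
        Finset.card_biUnion_le_card_mul _ _ _ fun b _ => (hQ b).trans (by gcongr; exact hSc b)
    _ = 48 * (A.card * B.card ^ 3) := by rw [Finset.card_product]; ring
end

noncomputable section

variable {A B : Finset Plane}

/-! ### Candidates -/

theorem card_le_card_candidates_at (hAB : B.card ≤ A.card) (t : Plane) {b : Plane} (hb : b ∈ B) :
    ∃ Q : Finset Plane, Q ⊆ A ∧ B.card ≤ Q.card ∧ ∀ a ∈ Q, (a, b) ∈ candidates A B t := by
  classical
  set Q := A.filter fun a => (a, b) ∈ candidates A B t with hQ
  refine ⟨Q, Finset.filter_subset _ _, ?_, fun a ha => (Finset.mem_filter.1 ha).2⟩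
  by_contra! hlt
  have hne : (A \ Q).Nonempty := by
    rw [Finset.sdiff_nonempty]
    exact fun h => absurd (Finset.card_le_card h) (not_le.2 (hlt.trans_le hAB))
  obtain ⟨a, ha, hmin⟩ := (A \ Q).exists_min_image (fun a => ‖b + t - a‖) hne
  obtain ⟨haA, haQ⟩ := Finset.mem_sdiff.1 ha
  refine haQ (Finset.mem_filter.2 ⟨haA, haA, hb, lt_of_le_of_lt (Finset.card_le_card ?_) hlt⟩)
  intro x hx
  obtain ⟨hxA, hx⟩ := Finset.mem_filter.1 hx
  by_contra hxQ
  exact absurd (hmin x (Finset.mem_sdiff.2 ⟨hxA, hxQ⟩)) (not_le.2 hx)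

theorem norm_lt_of_notMem_candidates {t a a' b : Plane} (h : (a, b) ∈ candidates A B t)
    (ha' : a' ∈ A) (h' : (a', b) ∉ candidates A B t) : ‖b + t - a‖ < ‖b + t - a'‖ := by
  by_contra! hcon
  refine h' ⟨ha', h.2.1, lt_of_le_of_lt (Finset.card_le_card fun x hx => ?_) h.2.2⟩
  rw [Finset.mem_filter] at hx ⊢
  exact ⟨hx.1, hx.2.trans_le hcon⟩

theorem norm_edge_lt_iff_of_sign {a b a' b' s t : Plane}
    (h : SignType.sign (bisForm (a - b) (a' - b') s) =
      SignType.sign (bisForm (a - b) (a' - b') t)) :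
    ‖b + s - a‖ < ‖b' + s - a'‖ ↔ ‖b + t - a‖ < ‖b' + t - a'‖ := by
  rw [norm_edge_lt_iff, norm_edge_lt_iff, ← sign_eq_neg_one_iff, h, sign_eq_neg_one_iff]

/-- If `ab` stopped being a candidate, the at least `k` candidates at `b` for `t` would all be
strictly shorter than `ab` at `t`. By the equality of signs they would be shorter at `s` as well,
where fewer than `k` edges are. Only signs for pairs inside the union are needed, exactly the pairs
that can make a bisector used. -/
theorem candidates_subset_of_sign (hAB : B.card ≤ A.card) {s t : Plane}
    (h : ∀ e ∈ candidates A B s ∪ candidates A B t, ∀ e' ∈ candidates A B s ∪ candidates A B t,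
      SignType.sign (bisForm (e.1 - e.2) (e'.1 - e'.2) s) =
        SignType.sign (bisForm (e.1 - e.2) (e'.1 - e'.2) t)) :
    candidates A B s ⊆ candidates A B t := by
  rintro ⟨a, b⟩ he
  by_contra hcon
  obtain ⟨Q, hQA, hQ, hQc⟩ := card_le_card_candidates_at hAB t he.2.1
  refine absurd he.2.2 (not_lt.2 (hQ.trans (Finset.card_le_card fun x hx => ?_)))
  refine Finset.mem_filter.2 ⟨hQA hx, ?_⟩
  exact (norm_edge_lt_iff_of_sign (h (x, b) (Or.inr (hQc x hx)) (a, b) (Or.inl he))).2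
    (norm_lt_of_notMem_candidates (hQc x hx) he.1 hcon)

/-- `s` and `t` have the same candidates, in the same order of length. -/
def SameCandidateOrder (A B : Finset Plane) (s t : Plane) : Prop :=
  candidates A B s = candidates A B t ∧ ∀ e ∈ candidates A B s, ∀ e' ∈ candidates A B s,
    SignType.sign (bisForm (e.1 - e.2) (e'.1 - e'.2) s) =
      SignType.sign (bisForm (e.1 - e.2) (e'.1 - e'.2) t)

theorem SameCandidateOrder.trans {s t u : Plane} (h : SameCandidateOrder A B s t)
    (h' : SameCandidateOrder A B t u) : SameCandidateOrder A B s u :=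
  ⟨h.1.trans h'.1, fun e he e' he' => (h.2 e he e' he').trans
    (h'.2 e (h.1 ▸ he) e' (h.1 ▸ he'))⟩

theorem SameCandidateOrder.of_sign (hAB : B.card ≤ A.card) {s t : Plane}
    (h : ∀ e ∈ candidates A B s ∪ candidates A B t, ∀ e' ∈ candidates A B s ∪ candidates A B t,
      SignType.sign (bisForm (e.1 - e.2) (e'.1 - e'.2) s) =
        SignType.sign (bisForm (e.1 - e.2) (e'.1 - e'.2) t)) : SameCandidateOrder A B s t := by
  refine ⟨(candidates_subset_of_sign hAB h).antisymm (candidates_subset_of_sign hAB ?_),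
    fun e he e' he' => h e (Or.inl he) e' (Or.inl he')⟩
  intro e he e' he'
  exact (h e he.symm e' he'.symm).symm

/-! ### Crossing a bisector -/

theorem finrank_vectorSpan_closedFace {κ : Type*} {f : κ → Plane →ᵃ[ℝ] ℝ} {H : Set κ}
    (hH : H.Finite) {h₀ : κ} (hh₀ : h₀ ∈ H) (hl : (f h₀).linear ≠ 0) {x : Plane}
    (hx : f h₀ x = 0) (hne : ∀ h ∈ H, h ≠ h₀ → f h x ≠ 0) :
    Module.finrank ℝ (vectorSpan ℝ (closedFace f H x)) = 1 := by
  have hr : Module.finrank ℝ (f h₀).linear.range = 1 := by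
    rw [LinearMap.range_eq_top.2 (LinearMap.surjective hl), finrank_top, Module.finrank_self]
  have hk : Module.finrank ℝ (f h₀).linear.ker = 1 := by
    have := (f h₀).linear.finrank_range_add_finrank_ker
    rw [hr, finrank_euclideanSpace_fin] at this
    omega
  have hz : ∀ y ∈ closedFace f H x, f h₀ y = 0 := fun y hy =>
    le_antisymm ((hy h₀ hh₀).2 hx.le) ((hy h₀ hh₀).1 hx.ge)
  have hle : vectorSpan ℝ (closedFace f H x) ≤ (f h₀).linear.ker := by
    rw [vectorSpan_def, Submodule.span_le]
    rintro _ ⟨y, hy, z, hz', rfl⟩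
    change (f h₀).linear (y -ᵥ z) = 0
    rw [AffineMap.linearMap_vsub, hz y hy, hz z hz', vsub_self]
  refine le_antisymm (hk ▸ Submodule.finrank_mono hle) ?_
  obtain ⟨⟨w, hw⟩, hw0⟩ := Module.finrank_pos_iff_exists_ne_zero.1 (hk ▸ Nat.one_pos :
    0 < Module.finrank ℝ (f h₀).linear.ker)
  have hw0 : w ≠ 0 := fun h => hw0 (Subtype.ext h)
  have hc : Continuous fun ε : ℝ => x + ε • w := by fun_prop
  have ht := hc.tendsto 0
  rw [zero_smul, add_zero] at ht
  have hev : ∀ᶠ y in nhds x, ∀ h ∈ H, h ≠ h₀ → SignType.sign (f h x) = SignType.sign (f h y) := by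
    refine (Filter.eventually_all_finite hH).2 fun h hh => ?_
    by_cases h1 : h = h₀
    · simp [h1]
    · filter_upwards [eventually_sign_eq (hne h hh h1)] with y hy _ using hy
  obtain ⟨ε, h1, h2⟩ := (((ht.eventually hev).filter_mono
    (nhdsWithin_le_nhds (s := Set.Ioi 0))).and self_mem_nhdsWithin).exists
  have h2 : 0 < ε := h2
  have hmem : x + ε • w ∈ closedFace f H x := by
    refine openFace_subset_closedFace x fun h hh => ?_
    by_cases h3 : h = h₀
    · subst h3
      rw [hx, add_comm, ← vadd_eq_add, AffineMap.map_vadd, map_smul, LinearMap.mem_ker.1 hw, hx]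
      simp
    · exact h1 h hh h3
  have hv := vsub_mem_vectorSpan ℝ hmem (mem_closedFace_self x)
  rw [Nat.succ_le_iff, Module.finrank_pos_iff_exists_ne_zero]
  refine ⟨⟨_, hv⟩, fun h => ?_⟩
  have := congrArg Subtype.val h
  simp [h2.ne', hw0] at this

theorem exists_crossing (g : Plane →ᵃ[ℝ] ℝ) {s t : Plane} (hs : g s ≠ 0) (ht : g t ≠ 0)
    (hst : SignType.sign (g s) ≠ SignType.sign (g t)) :
    ∃ c : ℝ, 0 < c ∧ c < 1 ∧ g (AffineMap.lineMap s t c) = 0 := by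
  have := (segment_subset_or_disjoint_iff g s t).not.2 hst
  rw [not_or, Set.not_disjoint_iff, segment_eq_image_lineMap] at this
  obtain ⟨-, _, ⟨c, hc, rfl⟩, h0⟩ := this
  have h0 : g _ = 0 := h0
  refine ⟨c, hc.1.lt_of_ne ?_, hc.2.lt_of_ne ?_, h0⟩
  · rintro rfl
    rw [AffineMap.lineMap_apply_zero] at h0
    exact hs h0
  · rintro rfl
    rw [AffineMap.lineMap_apply_one] at h0
    exact ht h0

theorem sign_lineMap {g : Plane →ᵃ[ℝ] ℝ} {s t : Plane}
    (hst : SignType.sign (g s) = SignType.sign (g t)) {c : ℝ} (hc0 : 0 < c) (hc1 : c < 1) :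
    SignType.sign (g (AffineMap.lineMap s t c)) = SignType.sign (g s) := by
  rw [affine_lineMap]
  rcases lt_trichotomy (g s) 0 with h2 | h2 | h2
  · have h3 := sign_eq_neg_one_iff.1 (hst ▸ sign_neg h2)
    rw [sign_neg h2, sign_neg]
    nlinarith [mul_pos (sub_pos.2 hc1) (neg_pos.2 h2), mul_pos hc0 (neg_pos.2 h3)]
  · have h3 : g t = 0 := by rw [h2, sign_zero] at hst; exact sign_eq_zero_iff.1 hst.symm
    rw [h2, h3]; simp
  · have h3 := sign_eq_one_iff.1 (hst ▸ sign_pos h2)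
    rw [sign_pos h2, sign_pos]
    nlinarith [mul_pos (sub_pos.2 hc1) h2, mul_pos hc0 h3]

/-- The bisectors that separate `s` from `t`. -/
def separators (A B : Finset Plane) (s t : Plane) : Set (Set Plane) :=
  {h ∈ bisectors A B | SignType.sign (lineForm h s) ≠ SignType.sign (lineForm h t)}

theorem finite_separators (s t : Plane) : (separators A B s t).Finite :=
  (finite_bisectors A B).subset fun _ h => h.1

theorem isLexCell_closedFace {s : Plane} (hs : ∀ h ∈ bisectors A B, lineForm h s ≠ 0) :
    IsLexCell A B (closedFace lineForm (bisectors A B) s) := by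
  refine ⟨?_, s, ?_⟩
  · rw [lexArrangement, arrangement_eq isLine_of_mem_bisectors]
    exact ⟨s, rfl⟩
  · exact interior_maximal (openFace_subset_closedFace s)
      (isOpen_openFace (finite_bisectors A B) hs) (mem_openFace_self s)

theorem mem_cellCandidates {s : Plane} (hs : ∀ h ∈ bisectors A B, lineForm h s ≠ 0)
    {e : Plane × Plane} (he : e ∈ candidates A B s) :
    e ∈ cellCandidates A B (closedFace lineForm (bisectors A B) s) :=
  ⟨s, interior_maximal (openFace_subset_closedFace s)
      (isOpen_openFace (finite_bisectors A B) hs) (mem_openFace_self s), he⟩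

theorem closedFace_iff_of_sign {g : Plane →ᵃ[ℝ] ℝ} {s t : Plane}
    (h : SignType.sign (g s) = SignType.sign (g t)) (y : Plane) :
    ((0 ≤ g s → 0 ≤ g y) ∧ (g s ≤ 0 → g y ≤ 0)) ↔
      ((0 ≤ g t → 0 ≤ g y) ∧ (g t ≤ 0 → g y ≤ 0)) := by
  rw [← sign_nonneg_iff (a := g s), ← sign_nonpos_iff (a := g s), h, sign_nonneg_iff,
    sign_nonpos_iff]

/-- Two adjacent cells are joined by an edge inside the bisector that separates them. -/
theorem exists_isLexEdge {s t : Plane} (hs : ∀ h ∈ bisectors A B, lineForm h s ≠ 0)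
    (ht : ∀ h ∈ bisectors A B, lineForm h t ≠ 0) {h₀ : Set Plane}
    (hsep : separators A B s t = {h₀}) :
    ∃ F, IsLexEdge A B F (closedFace lineForm (bisectors A B) s)
      (closedFace lineForm (bisectors A B) t) ∧ F ⊆ h₀ := by
  have hh₀ : h₀ ∈ separators A B s t := hsep ▸ rfl
  have heq : ∀ h ∈ bisectors A B, h ≠ h₀ →
      SignType.sign (lineForm h s) = SignType.sign (lineForm h t) := fun h hh hne => by
    by_contra hcon
    have : h ∈ separators A B s t := ⟨hh, hcon⟩
    rw [hsep] at this
    exact hne this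
  obtain ⟨c, hc0, hc1, hc⟩ := exists_crossing (lineForm h₀) (hs _ hh₀.1) (ht _ hh₀.1) hh₀.2
  set x : Plane := AffineMap.lineMap s t c with hx
  have hxs : ∀ h ∈ bisectors A B, h ≠ h₀ →
      SignType.sign (lineForm h x) = SignType.sign (lineForm h s) := fun h hh hne =>
    sign_lineMap (heq h hh hne) hc0 hc1
  have hl := isLine_of_mem_bisectors h₀ hh₀.1
  refine ⟨closedFace lineForm (bisectors A B) x, ⟨?_, ?_, isLexCell_closedFace hs,
    isLexCell_closedFace ht, ?_⟩, ?_⟩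
  · rw [lexArrangement, arrangement_eq isLine_of_mem_bisectors]
    exact ⟨x, rfl⟩
  · refine finrank_vectorSpan_closedFace (finite_bisectors A B) hh₀.1 hl.linear_ne_zero hc
      fun h hh hne h0 => hs h hh ?_
    have := hxs h hh hne
    rw [h0, sign_zero] at this
    exact sign_eq_zero_iff.1 this.symm
  · ext y
    constructor
    · intro hy
      have hy0 : lineForm h₀ y = 0 :=
        le_antisymm ((hy h₀ hh₀.1).2 hc.le) ((hy h₀ hh₀.1).1 hc.ge)
      constructor
      · intro h hh
        by_cases hne : h = h₀
        · subst hne; simp [hy0]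
        · exact (closedFace_iff_of_sign (hxs h hh hne) y).1 (hy h hh)
      · intro h hh
        by_cases hne : h = h₀
        · subst hne; simp [hy0]
        · exact (closedFace_iff_of_sign ((hxs h hh hne).trans (heq h hh hne)) y).1 (hy h hh)
    · rintro ⟨hy, hy'⟩ h hh
      by_cases hne : h = h₀
      · subst hne
        have h1 := hy h hh
        have h2 := hy' h hh
        have : lineForm h y = 0 := by
          rcases lt_or_gt_of_ne (hs h hh) with a | a <;> rcases lt_or_gt_of_ne (ht h hh) with b | b
          · exact absurd (by rw [sign_neg a, sign_neg b]) hh₀.2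
          · exact le_antisymm (h1.2 a.le) (h2.1 b.le)
          · exact le_antisymm (h2.2 b.le) (h1.1 a.le)
          · exact absurd (by rw [sign_pos a, sign_pos b]) hh₀.2
        simp [this]
      · exact (closedFace_iff_of_sign (hxs h hh hne) y).2 (hy h hh)
  · intro y hy
    rw [hl.mem_iff]
    exact le_antisymm ((hy h₀ hh₀.1).2 hc.le) ((hy h₀ hh₀.1).1 hc.ge)

/-- If the bisector of two edges from the union of the candidate sets separated `s` from `t`, it
would be the only separator. The edge of `lex(A, B)` between the two cells would then use it. -/
theorem sameCandidateOrder_of_adjacent (hAB : B.card ≤ A.card) {s t : Plane}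
    (hs : ∀ h ∈ bisectors A B, lineForm h s ≠ 0) (ht : ∀ h ∈ bisectors A B, lineForm h t ≠ 0)
    (hu : ∀ h ∈ usedBisectors A B, h ∉ separators A B s t)
    (hsub : (separators A B s t).Subsingleton) : SameCandidateOrder A B s t := by
  refine SameCandidateOrder.of_sign hAB fun e he e' he' => ?_
  obtain ⟨a, b⟩ := e
  obtain ⟨a', b'⟩ := e'
  have hmem : ∀ e ∈ candidates A B s ∪ candidates A B t, e.1 ∈ A ∧ e.2 ∈ B := by
    rintro e (h | h)
    · exact ⟨h.1, h.2.1⟩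
    · exact ⟨h.1, h.2.1⟩
  obtain ⟨ha, hb⟩ := hmem _ he
  obtain ⟨ha', hb'⟩ := hmem _ he'
  simp only at ha hb ha' hb' ⊢
  by_cases hne : b - a = b' - a'
  · have : a - b = a' - b' := by rw [← neg_sub b a, hne, neg_sub]
    rw [this, bisForm_apply, bisForm_apply]; simp
  have hbis : bisector a b a' b' ∈ bisectors A B := ⟨a, ha, b, hb, a', ha', b', hb', hne, rfl⟩
  have hns : bisector a b a' b' ∉ separators A B s t := by
    intro hmem
    obtain ⟨F, hF, hFh⟩ := exists_isLexEdge hs ht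
      (hsub.eq_singleton_of_mem hmem)
    have hcc : ∀ e ∈ candidates A B s ∪ candidates A B t,
        e ∈ cellCandidates A B (closedFace lineForm (bisectors A B) s) ∪
          cellCandidates A B (closedFace lineForm (bisectors A B) t) := by
      rintro e (h | h)
      · exact Or.inl (mem_cellCandidates hs h)
      · exact Or.inr (mem_cellCandidates ht h)
    exact hu _ ⟨a, ha, b, hb, a', ha', b', hb', hne, rfl, F, _, _, hF, hFh, hcc _ he, hcc _ he'⟩ hmem
  have hsign : SignType.sign (lineForm (bisector a b a' b') s) =
      SignType.sign (lineForm (bisector a b a' b') t) := by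
    by_contra hcon
    exact hns ⟨hbis, hcon⟩
  refine sign_eq_of_mem_openFace (H := {bisector a b a' b'}) ?_ ?_
    (Set.mem_singleton_iff.2 (bisector_eq a b a' b').symm)
  · rintro _ rfl
    exact isLine_of_mem_bisectors _ hbis
  · rintro _ rfl
    exact hsign

theorem IsLine.eq_of_subset {h h' : Set Plane} (hh : IsLine h) (hh' : IsLine h') {x : Plane}
    (hx : x ∈ h) (hsub : h ⊆ h') : h = h' := by
  have hr : Module.finrank ℝ (lineForm h).linear.range = 1 := by
    rw [LinearMap.range_eq_top.2 (LinearMap.surjective hh.linear_ne_zero), finrank_top,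
      Module.finrank_self]
  have hk : 0 < Module.finrank ℝ (lineForm h).linear.ker := by
    have := (lineForm h).linear.finrank_range_add_finrank_ker
    rw [hr, finrank_euclideanSpace_fin] at this
    omega
  obtain ⟨⟨w, hw⟩, hw0⟩ := Module.finrank_pos_iff_exists_ne_zero.1 hk
  have hw0 : w ≠ 0 := fun h => hw0 (Subtype.ext h)
  have hy : w + x ∈ h := by
    rw [hh.mem_iff, ← vadd_eq_add, AffineMap.map_vadd, LinearMap.mem_ker.1 hw,
      (hh.mem_iff x).1 hx]
    simp
  refine hsub.antisymm fun z hz => ?_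
  rw [hh.mem_iff]
  rw [hh'.mem_iff] at hz
  exact eq_zero_of_two_zeros hh'.linear_ne_zero (x := x) (y := w + x) (by simpa using hw0)
    ((hh'.mem_iff _).1 (hsub hx)) ((hh'.mem_iff _).1 (hsub hy)) hz ((hh.mem_iff _).1 hx)
    ((hh.mem_iff _).1 hy)

/-- Between two points that are separated by two bisectors there is an intermediate point. -/
theorem exists_generic_between {s t : Plane} (hs : ∀ h ∈ bisectors A B, lineForm h s ≠ 0)
    (ht : ∀ h ∈ bisectors A B, lineForm h t ≠ 0) (hnt : (separators A B s t).Nontrivial) :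
    ∃ m, (∀ h ∈ bisectors A B, lineForm h m ≠ 0) ∧ separators A B s m ⊂ separators A B s t ∧
      separators A B m t ⊂ separators A B s t := by
  obtain ⟨h₁, hh₁, h₂, hh₂, hne⟩ := hnt
  have hl₁ := isLine_of_mem_bisectors h₁ hh₁.1
  have hl₂ := isLine_of_mem_bisectors h₂ hh₂.1
  have heq : ∀ h ∈ bisectors A B, h ∉ separators A B s t →
      SignType.sign (lineForm h s) = SignType.sign (lineForm h t) := fun h hh hn => by
    by_contra hcon
    exact hn ⟨hh, hcon⟩
  have hline : ∀ (x y : Plane) {P : Plane → Prop}, (∀ᶠ z in nhds x, P z) →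
      ∃ δ > (0 : ℝ), P (AffineMap.lineMap x y δ) := by
    intro x y P hP
    have := (continuous_lineMap_plane x y).tendsto 0
    rw [AffineMap.lineMap_apply_zero] at this
    obtain ⟨δ, h1, h2⟩ := (((this.eventually hP).filter_mono
      (nhdsWithin_le_nhds (s := Set.Ioi 0))).and self_mem_nhdsWithin).exists
    exact ⟨δ, h2, h1⟩
  have hopen : ∀ x : Plane, (∀ h ∈ bisectors A B, h ∉ separators A B s t →
      SignType.sign (lineForm h x) = SignType.sign (lineForm h s)) →
      ∀ᶠ y in nhds x, ∀ h ∈ bisectors A B, h ∉ separators A B s t →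
        SignType.sign (lineForm h y) = SignType.sign (lineForm h s) := by
    intro x hx
    refine (Filter.eventually_all_finite (finite_bisectors A B)).2 fun h hh => ?_
    by_cases hsep : h ∈ separators A B s t
    · simp [hsep]
    · have hx' := hx h hh hsep
      have : lineForm h x ≠ 0 := fun h0 => by
        rw [h0, sign_zero] at hx'
        exact hs h hh (sign_eq_zero_iff.1 hx'.symm)
      filter_upwards [eventually_sign_eq this] with y hy _
      rw [← hy, hx']
  obtain ⟨y₀, hy₀, hy₁, hy₂⟩ : ∃ y₀, (∀ h ∈ bisectors A B, h ∉ separators A B s t →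
      SignType.sign (lineForm h y₀) = SignType.sign (lineForm h s)) ∧ lineForm h₁ y₀ = 0 ∧
      -- The segment from `s` to `t` may meet both lines at the same point, so walking along it need
      -- not cross them one at a time. In that case the crossing point is moved slightly along `h₁`,
      -- off `h₂`, without crossing a bisector that does not separate `s` from `t`.
      lineForm h₂ y₀ ≠ 0 := by
    obtain ⟨c, hc0, hc1, hc⟩ := exists_crossing (lineForm h₁) (hs _ hh₁.1) (ht _ hh₁.1) hh₁.2
    set x : Plane := AffineMap.lineMap s t c with hx
    have hxs : ∀ h ∈ bisectors A B, h ∉ separators A B s t →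
        SignType.sign (lineForm h x) = SignType.sign (lineForm h s) := fun h hh hn =>
      sign_lineMap (heq h hh hn) hc0 hc1
    by_cases h0 : lineForm h₂ x = 0
    · obtain ⟨y, hy, hy'⟩ : ∃ y ∈ h₁, y ∉ h₂ := by
        by_contra! hcon
        exact hne (hl₁.eq_of_subset hl₂ ((hl₁.mem_iff x).2 hc) hcon)
      rw [hl₁.mem_iff] at hy
      rw [hl₂.mem_iff] at hy'
      obtain ⟨δ, hδ, hP⟩ := hline x y (hopen x hxs)
      refine ⟨_, hP, ?_, ?_⟩
      · rw [affine_lineMap, hc, hy]; simp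
      · rw [affine_lineMap, h0]
        simp [hδ.ne', hy']
    · exact ⟨x, hxs, hc, h0⟩
  have key : ∀ τ : Plane, lineForm h₁ τ ≠ 0 → ∃ m, (∀ h ∈ bisectors A B, lineForm h m ≠ 0) ∧
      (∀ h ∈ bisectors A B, h ∉ separators A B s t →
        SignType.sign (lineForm h m) = SignType.sign (lineForm h s)) ∧
      SignType.sign (lineForm h₁ m) = SignType.sign (lineForm h₁ τ) ∧
      SignType.sign (lineForm h₂ m) = SignType.sign (lineForm h₂ y₀) := by
    intro τ hτ
    obtain ⟨δ, hδ, hP⟩ := hline y₀ τ (((hopen y₀ hy₀).and (eventually_sign_eq hy₂)).eventually_nhds)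
    have h1 : lineForm h₁ (AffineMap.lineMap y₀ τ δ) = δ * lineForm h₁ τ := by
      rw [affine_lineMap, hy₁]; simp
    have h1' : SignType.sign (lineForm h₁ (AffineMap.lineMap y₀ τ δ)) =
        SignType.sign (lineForm h₁ τ) := by
      rw [h1, sign_mul, sign_pos hδ, one_mul]
    have h2 : lineForm h₁ (AffineMap.lineMap y₀ τ δ) ≠ 0 := by
      rw [h1]; exact mul_ne_zero hδ.ne' hτ
    obtain ⟨m, hm, hm', hm''⟩ := (dense_generic (finite_bisectors A B)
      linear_lineForm_ne_zero).inter_nhds_nonempty (hP.and (eventually_sign_eq h2))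
    exact ⟨m, hm, hm'.1, hm''.symm.trans h1', hm'.2.symm⟩
  have hsub : ∀ m, (∀ h ∈ bisectors A B, h ∉ separators A B s t →
        SignType.sign (lineForm h m) = SignType.sign (lineForm h s)) →
      separators A B s m ⊆ separators A B s t ∧ separators A B m t ⊆ separators A B s t := by
    intro m hm
    refine ⟨fun h hh => ?_, fun h hh => ?_⟩
    · by_contra hn
      exact hh.2 (hm h hh.1 hn).symm
    · by_contra hn
      exact hh.2 ((hm h hh.1 hn).trans (heq h hh.1 hn))
  -- Near `y₀` both sides of `h₁` are available. If `y₀` is on the side of `s` for `h₂`, take `m` on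
  -- the side of `t` for `h₁`, and vice versa. Then each half of the detour loses one separator, and
  -- neither gains any.
  by_cases hcase : SignType.sign (lineForm h₂ y₀) = SignType.sign (lineForm h₂ s)
  · obtain ⟨m, hm, hm', h1, h2⟩ := key t (ht _ hh₁.1)
    obtain ⟨s1, s2⟩ := hsub m hm'
    refine ⟨m, hm, s1.ssubset_of_mem_notMem hh₂ fun h => h.2 ?_,
      s2.ssubset_of_mem_notMem hh₁ fun h => h.2 h1⟩
    rw [h2, hcase]
  · obtain ⟨m, hm, hm', h1, h2⟩ := key s (hs _ hh₁.1)
    obtain ⟨s1, s2⟩ := hsub m hm'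
    refine ⟨m, hm, s1.ssubset_of_mem_notMem hh₁ fun h => h.2 h1.symm,
      s2.ssubset_of_mem_notMem hh₂ fun h => h.2 ?_⟩
    rw [h2]
    have a := hh₂.2
    have b1 := sign_ne_zero.2 hy₂
    have b2 := sign_ne_zero.2 (hs _ hh₂.1)
    have b3 := sign_ne_zero.2 (ht _ hh₂.1)
    revert hcase a b1 b2 b3
    generalize SignType.sign (lineForm h₂ y₀) = u
    generalize SignType.sign (lineForm h₂ s) = v
    generalize SignType.sign (lineForm h₂ t) = w
    revert u v w
    decide

/-- The candidates and their order are constant on the generic points of a cell of the reduced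
arrangement. -/
theorem sameCandidateOrder_of_not_separated (hAB : B.card ≤ A.card) {s t : Plane}
    (hs : ∀ h ∈ bisectors A B, lineForm h s ≠ 0) (ht : ∀ h ∈ bisectors A B, lineForm h t ≠ 0)
    (hu : ∀ h ∈ usedBisectors A B, h ∉ separators A B s t) : SameCandidateOrder A B s t := by
  induction hn : (separators A B s t).ncard using Nat.strong_induction_on generalizing s t with
  | _ n ih =>
    subst hn
    rcases (separators A B s t).subsingleton_or_nontrivial with h | h
    · exact sameCandidateOrder_of_adjacent hAB hs ht hu h
    · obtain ⟨m, hm, h1, h2⟩ := exists_generic_between hs ht h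
      refine SameCandidateOrder.trans
        (ih _ (Set.ncard_lt_ncard h1 (finite_separators _ _)) hs hm
          (fun h hh hcon => hu h hh (h1.1 hcon)) rfl)
        (ih _ (Set.ncard_lt_ncard h2 (finite_separators _ _)) hm ht
          (fun h hh hcon => hu h hh (h2.1 hcon)) rfl)

/-! ### The reduced arrangement is a lex-bottleneck diagram -/

/-- Weak inequalities that hold at the generic points of a cell extend to the closed cell. -/
theorem le_zero_of_generic {s' : Plane} (hs' : ∀ h ∈ bisectors A B, lineForm h s' ≠ 0)
    {g : Plane →ᵃ[ℝ] ℝ} (hg : ∀ u ∈ openFace lineForm (usedBisectors A B) s',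
      (∀ h ∈ bisectors A B, lineForm h u ≠ 0) → g u ≤ 0) {t : Plane}
    (ht : t ∈ closedFace lineForm (usedBisectors A B) s') : g t ≤ 0 := by
  have hclosed : IsClosed {x | g x ≤ 0} := isClosed_le (continuous_affine g) continuous_const
  have hopen : IsOpen (openFace lineForm (usedBisectors A B) s') :=
    isOpen_openFace ((finite_bisectors A B).subset (usedBisectors_subset A B))
      fun h hh => hs' h (usedBisectors_subset A B hh)
  have hsub := (dense_generic (finite_bisectors A B) linear_lineForm_ne_zero
    (f := lineForm)).open_subset_closure_inter hopen
  rw [← closure_openFace] at ht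
  refine closure_minimal (hsub.trans (closure_minimal ?_ hclosed)) hclosed ht
  rintro u ⟨hu, hu'⟩
  exact hg u hu hu'

theorem exists_optimal_on_openFace (hAB : B.card ≤ A.card) (s : Plane) :
    ∃ π : ↥B ↪ ↥A, ∀ t ∈ openFace lineForm (usedBisectors A B) s, ∀ σ : ↥B ↪ ↥A,
      lexCost π t ≤ lexCost σ t := by
  classical
  have hfin : (usedBisectors A B).Finite :=
    (finite_bisectors A B).subset (usedBisectors_subset A B)
  -- The candidates are taken at a generic nearby `s'` and not at `s`, where discarded bisectors may
  -- create ties. Only weak inequalities then pass to the face of `s`, and these suffice.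
  obtain ⟨s', hs', hsub⟩ := exists_generic_closedFace (f := lineForm) (finite_bisectors A B)
    linear_lineForm_ne_zero (usedBisectors_subset A B) s
  set Z := candidates A B s' with hZ
  have hsame : ∀ u ∈ openFace lineForm (usedBisectors A B) s',
      (∀ h ∈ bisectors A B, lineForm h u ≠ 0) → SameCandidateOrder A B s' u := fun u hu hu' =>
    sameCandidateOrder_of_not_separated hAB hs' hu' fun h hh hcon => hcon.2 (hu h hh)
  have hout : ∀ t ∈ openFace lineForm (usedBisectors A B) s, ∀ b ∈ B, ∀ a ∈ A, ∀ a' ∈ A,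
      (a, b) ∈ Z → (a', b) ∉ Z → ‖b + t - a‖ ≤ ‖b + t - a'‖ := by
    intro t ht b _ a _ a' ha' hmem hnmem
    rw [norm_edge_le_iff]
    refine le_zero_of_generic hs' (fun u hu hu' => ?_) (hsub ht)
    rw [← norm_edge_le_iff]
    have h := (hsame u hu hu').1
    rw [hZ, h] at hmem hnmem
    exact (norm_lt_of_notMem_candidates hmem ha' hnmem).le
  have hin : ∀ e ∈ Z, ∀ e' ∈ Z, bisForm (e.1 - e.2) (e'.1 - e'.2) s' ≤ 0 →
      ∀ t ∈ openFace lineForm (usedBisectors A B) s,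
        bisForm (e.1 - e.2) (e'.1 - e'.2) t ≤ 0 := by
    intro e he e' he' h t ht
    refine le_zero_of_generic hs' (fun u hu hu' => ?_) (hsub ht)
    rw [← sign_nonpos_iff] at h ⊢
    rwa [← (hsame u hu hu').2 e he e' he']
  have hneg : ∀ p q t : Plane, bisForm p q t = -bisForm q p t := fun p q t => by
    rw [bisForm_apply, bisForm_apply]; ring
  have horder : ∀ t ∈ openFace lineForm (usedBisectors A B) s, ∀ e ∈ Z, ∀ e' ∈ Z,
      ‖e.2 + s - e.1‖ ≤ ‖e'.2 + s - e'.1‖ ↔ ‖e.2 + t - e.1‖ ≤ ‖e'.2 + t - e'.1‖ := by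
    intro t ht e he e' he'
    rw [norm_edge_le_iff, norm_edge_le_iff]
    have hss := mem_openFace_self (f := lineForm) (H := usedBisectors A B) s
    -- On the open face of `s` the difference of squared lengths keeps a weak sign, and
    -- `eq_zero_of_nonneg` makes it vanish everywhere or nowhere, so ties are constant too.
    rcases le_total (bisForm (e.1 - e.2) (e'.1 - e'.2) s') 0 with h | h
    · exact ⟨fun _ => hin e he e' he' h t ht, fun _ => hin e he e' he' h s hss⟩
    · have hge : ∀ x ∈ openFace lineForm (usedBisectors A B) s,
          0 ≤ bisForm (e.1 - e.2) (e'.1 - e'.2) x := fun x hx => by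
        rw [hneg] at h ⊢
        have := hin e' he' e he (by linarith) x hx
        linarith
      exact ⟨fun h0 => (eq_zero_of_nonneg hfin hge hss ht (le_antisymm h0 (hge s hss))).le,
        fun h0 => (eq_zero_of_nonneg hfin hge ht hss (le_antisymm h0 (hge t ht))).le⟩
  have hcard : ∀ b ∈ B, ∃ Q : Finset Plane, Q ⊆ A ∧ B.card ≤ Q.card ∧ ∀ a ∈ Q, (a, b) ∈ Z :=
    fun b hb => card_le_card_candidates_at hAB s' hb
  obtain ⟨σ₀⟩ : Nonempty (↥B ↪ ↥A) :=
    Function.Embedding.nonempty_of_card_le (by simpa using hAB)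
  obtain ⟨σ₁, hσ₁, -⟩ := exists_matching_mem σ₀ s Z hcard (hout s (mem_openFace_self s))
  obtain ⟨π, hπ, hmin⟩ := (Finset.univ.filter fun σ : ↥B ↪ ↥A =>
    ∀ b : ↥B, ((σ b : Plane), (b : Plane)) ∈ Z).exists_min_image (fun σ => lexCost σ s)
    ⟨σ₁, Finset.mem_filter.2 ⟨Finset.mem_univ _, hσ₁⟩⟩
  refine ⟨π, fun t ht σ => ?_⟩
  obtain ⟨τ, hτ, hle⟩ := exists_matching_mem σ t Z hcard (hout t ht)
  exact (lexCost_le_of_order_iso Z (Finset.mem_filter.1 hπ).2 hτ (horder t ht)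
    (hmin τ (Finset.mem_filter.2 ⟨Finset.mem_univ _, hτ⟩))).trans (lexCost_le_of_forall_le hle)

theorem isLexBottleneckDiagram_reducedArrangement (hAB : B.card ≤ A.card) :
    IsLexBottleneckDiagram A B (reducedArrangement A B) := by
  have hfin : (usedBisectors A B).Finite :=
    (finite_bisectors A B).subset (usedBisectors_subset A B)
  rw [reducedArrangement, arrangement_eq isLine_of_mem_usedBisectors]
  refine ⟨isPolyhedralComplex_range_closedFace hfin
    fun h hh => (isLine_of_mem_usedBisectors h hh).linear_ne_zero, ?_, ?_⟩
  · exact Set.eq_univ_of_forall fun s => ⟨_, ⟨s, rfl⟩, mem_closedFace_self s⟩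
  · rintro _ ⟨s, rfl⟩
    obtain ⟨π, hπ⟩ := exists_optimal_on_openFace hAB s
    exact ⟨π, fun t ht => hπ t (intrinsicInterior_closedFace_subset s ht)⟩

theorem complexity_reducedArrangement_le :
    complexity (reducedArrangement A B) ≤ 2 * (usedBisectors A B).ncard ^ 2 + 1 := by
  rw [reducedArrangement, arrangement_eq isLine_of_mem_usedBisectors, complexity]
  have := encard_range_closedFace_le (f := lineForm)
    ((finite_bisectors A B).subset (usedBisectors_subset A B))
    fun h hh => (isLine_of_mem_usedBisectors h hh).linear_ne_zero
  exact ENat.toNat_le_of_le_natCast (by exact_mod_cast this)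

end

theorem theorem3p5 :
    ∃ K : ℕ, ∀ A B : Finset Plane, B.Nonempty → B.card ≤ A.card →
      IsLexBottleneckDiagram A B (reducedArrangement A B) ∧
      complexity (reducedArrangement A B) ≤ K * (A.card ^ 2 * B.card ^ 6) ∧
      (usedBisectors A B).Finite ∧
      (usedBisectors A B).ncard ≤ K * (A.card * B.card ^ 3) := by
  -- The constant is `2 * 48 ^ 2 + 1`: at most `48 * n * k ^ 3` used lines enter the quadratic face
  -- bound, and the summand `1` is absorbed by `n ^ 2 * k ^ 6 ≥ 1`.
  refine ⟨4609, fun A B hB hAB => ⟨isLexBottleneckDiagram_reducedArrangement hAB, ?_,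
    (finite_bisectors A B).subset (usedBisectors_subset A B), ?_⟩⟩
  · have hk : 0 < B.card := hB.card_pos
    have hn : 0 < A.card := hk.trans_le hAB
    have hpos : 1 ≤ A.card ^ 2 * B.card ^ 6 := Nat.mul_pos (pow_pos hn 2) (pow_pos hk 6)
    calc complexity (reducedArrangement A B) ≤ 2 * (usedBisectors A B).ncard ^ 2 + 1 :=
          complexity_reducedArrangement_le
      _ ≤ 2 * (48 * (A.card * B.card ^ 3)) ^ 2 + A.card ^ 2 * B.card ^ 6 := by
          gcongr
          exact ncard_usedBisectors_le hB
      _ = 4609 * (A.card ^ 2 * B.card ^ 6) := by ring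
  · exact (ncard_usedBisectors_le hB).trans (by gcongr; norm_num)
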